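/- **Theorem (Existence of a solution for the LP problem).** Let $T>0$, let $\mathcal O\subset\mathbb R$ be open with closure $\bar{\mathcal O}$, and let $A\subset\mathbb R$ be compact. Assume: 1. $b:[0,T]\times\mathbb R\times A\to\mathbb R$ and $\sigma:[0,T]\times\mathbb R\times A\to[0,\infty)$ are measurable, bounded, and Lipschitz in $x$ uniformly in $(t,a)$; 2. for each $t\in[0,T]$, $b(t,\cdot,\cdot)$ and $\sigma(t,\cdot,\cdot)$ are continuous on $\bar{\mathcal O}\times A$; 3. $f:[0,T]\times\bar{\mathcal O}\times A\to\mathbb R$ is measurable and bounded, with $f(t,\cdot,\cdot)$ upper semicontinuous for each $t\in[0,T]$, and $g:[0,T]\times\bar{\mathcal O}\to\mathbb R$ is upper semicontinuous and bounded from above; 4. $m_0^*$ is a Borel probability measure on $\mathcal O$ with $\int_{\mathcal O}\ln(1+|x|)\,m_0^*(dx)<\infty$. Let $V$ be the set of families $(m_t)_{t\in[0,T]}$ of finite signed Borel measures on $\bar{\mathcal O}\times A$ such that $t\mapsto m_t(B)$ is measurable for every Borel set $B$, $\int_0^T|m_t|(\bar{\mathcal O}\times A)\,dt<\infty$ (where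 $|m_t|$ is the total variation measure), and $m_t$ is a positive measure for almost every $t$; two families that coincide for almost every $t$ are identified. Let $C_b^{1,2}([0,T]\times\bar{\mathcal O})$ be the set of bounded continuous functions $u:[0,T]\times\bar{\mathcal O}\to\mathbb R$ whose derivatives $\partial_tu,\partial_xu,\partial_{xx}u$ (taken within $[0,T]$, respectively within $\bar{\mathcal O}$) exist and are bounded and continuous on $[0,T]\times\bar{\mathcal O}$. Let $\mathcal R$ be the set of pairs $(\mu,m)$, where $\mu$ is a Borel probability measure on $[0,T]\times\bar{\mathcal O}$ and $m\in V$, such that for all $u\in C_b^{1,2}([0,T]\times\bar{\mathcal O})$, $$\int_{[0,T]\times\bar{\mathcal O}}u\,d\mu=\int_{\mathcal O}u(0,x)\,m_0^*(dx)+\int_0^T\int_{\bar{\mathcal O}\times A}\Big(\partial_tu(t,x)+b(t,x,a)\,\partial_xu(t,x)+\tfrac{\sigma^2(t,x,a)}{2}\,\partial_{xx}u(t,x)\Big)m_t(dx,da)\,dt .$$ For $(\mu,m)\in\mathcal R$ put $$\Gamma(\mu,m)=\int_0^T\int_{\bar{\mathcal O}\times A}f(t,x,a)\,m_t(dx,da)\,dt+\int_{[0,T]\times\bar{\mathcal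 O}}g(t,x)\,\mu(dt,dx)\in\mathbb R\cup\{-\infty\}.$$ Then the linear program of maximizing $\Gamma$ over $\mathcal R$ has a solution: there exists $(\mu^\star,m^\star)\in\mathcal R$ with $$\Gamma(\mu^\star,m^\star)=\sup_{(\mu,m)\in\mathcal R}\Gamma(\mu,m).$$ -/

import Mathlib

open MeasureTheory Set
open scoped ENNReal

noncomputable section

namespace LPControl

/-- Lebesgue measure `dt` on `[0, T]`. -/
def timeMeasure (T : ℝ) : Measure (Icc (0 : ℝ) T) :=
  Measure.comap (fun t => (t : ℝ)) volume

/-- The space `V₀` of flows of measures: families `(m_t)`, `t ∈ [0, T]`, of finite signed Borel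
measures on `E` such that `t ↦ m_t(B)` is measurable for each Borel set `B`, and
`∫₀ᵀ |m_t|(E) dt < ∞`. -/
structure Flow (T : ℝ) (E : Type*) [MeasurableSpace E] where
  toFun : Icc (0 : ℝ) T → SignedMeasure E
  measurable_apply : ∀ B : Set E, MeasurableSet B → Measurable fun t => toFun t B
  finite_variation : ∫⁻ t, (toFun t).variation univ ∂(timeMeasure T) < ∞

/-- Two flows are identified if they coincide for almost every `t ∈ [0, T]`. -/
def flowSetoid (T : ℝ) (E : Type*) [MeasurableSpace E] : Setoid (Flow T E) where
  r m m' := m.toFun =ᵐ[timeMeasure T] m'.toFun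
  iseqv := ⟨fun _ => Filter.EventuallyEq.rfl, fun h => h.symm, fun h h' => h.trans h'⟩

/-- The space `V₁`: flows of measures up to almost everywhere equality in `t`. -/
def FlowClass (T : ℝ) (E : Type*) [MeasurableSpace E] : Type _ :=
  Quotient (flowSetoid T E)

/-- `∫₀ᵀ ∫ h(t, e) m_t(de) dt`. -/
def Flow.integral {T : ℝ} {E : Type*} [MeasurableSpace E] (m : Flow T E)
    (h : Icc (0 : ℝ) T × E → ℝ) : ℝ :=
  ∫ t, VectorMeasure.integral (m.toFun t) (fun e => h (t, e))
    (ContinuousLinearMap.lsmul ℝ ℝ).flip ∂(timeMeasure T)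

/-- `∫₀ᵀ ∫ h(t, e) m_t(de) dt` on classes of flows. -/
def FlowClass.integral {T : ℝ} {E : Type*} [MeasurableSpace E] (m : FlowClass T E)
    (h : Icc (0 : ℝ) T × E → ℝ) : ℝ :=
  Quotient.lift (s := flowSetoid T E) (fun m : Flow T E => m.integral h)
    (fun _ _ hmm' => integral_congr_ae (hmm'.mono fun t ht => by simp only [ht])) m

/-- For almost every `t`, the measure `m_t` is positive. -/
def FlowClass.IsPositive {T : ℝ} {E : Type*} [MeasurableSpace E] (m : FlowClass T E) : Prop :=
  Quotient.lift (s := flowSetoid T E) (fun m : Flow T E => ∀ᵐ t ∂(timeMeasure T), 0 ≤ m.toFun t)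
    (fun _ _ hmm' => propext
      ⟨fun h => by filter_upwards [h, hmm'] with t h1 h2 using h2 ▸ h1,
       fun h => by filter_upwards [h, hmm'] with t h1 h2 using h2 ▸ h1⟩) m

/-- The space `V`: classes of flows whose measures are positive for almost every `t`. -/
def PosFlow (T : ℝ) (E : Type*) [MeasurableSpace E] : Type _ :=
  {m : FlowClass T E // m.IsPositive}

/-- `∂_t u` on `[0, T]` (one-sided at the end points). -/
def timeDeriv (T : ℝ) (u : ℝ → ℝ → ℝ) (t x : ℝ) : ℝ :=
  derivWithin (fun s => u s x) (Icc 0 T) t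

/-- `∂_x u` on the set `K`, the derivative being taken within `K`. -/
def spaceDeriv (K : Set ℝ) (u : ℝ → ℝ → ℝ) (t x : ℝ) : ℝ :=
  derivWithin (fun y => u t y) K x

/-- The restriction of `u` to `[0, T] × K` is continuous and bounded. -/
def IsCb (T : ℝ) (K : Set ℝ) (u : ℝ → ℝ → ℝ) : Prop :=
  ContinuousOn (fun p : ℝ × ℝ => u p.1 p.2) (Icc 0 T ×ˢ K) ∧
    ∃ C : ℝ, ∀ t ∈ Icc (0 : ℝ) T, ∀ x ∈ K, |u t x| ≤ C

/-- The restriction of `u` to `[0, T] × K` is of class `C_b^{1,2}`: `u`, `∂_t u`, `∂_x u` and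
`∂_xx u` exist and are continuous and bounded on `[0, T] × K`. (Only the values of `u` on
`[0, T] × K` matter.) -/
structure IsCb12 (T : ℝ) (K : Set ℝ) (u : ℝ → ℝ → ℝ) : Prop where
  differentiable_time : ∀ t ∈ Icc (0 : ℝ) T, ∀ x ∈ K,
    DifferentiableWithinAt ℝ (fun s => u s x) (Icc 0 T) t
  differentiable_space : ∀ t ∈ Icc (0 : ℝ) T, ∀ x ∈ K,
    DifferentiableWithinAt ℝ (fun y => u t y) K x
  differentiable_space_two : ∀ t ∈ Icc (0 : ℝ) T, ∀ x ∈ K,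
    DifferentiableWithinAt ℝ (fun y => spaceDeriv K u t y) K x
  cb : IsCb T K u
  cb_time : IsCb T K (timeDeriv T u)
  cb_space : IsCb T K (spaceDeriv K u)
  cb_space_two : IsCb T K (spaceDeriv K (spaceDeriv K u))

/-- The class `𝒮`: bounded measurable `h` on `[0, T] × cl(O) × A` such that `h(t, ·)` is
continuous for each `t`. -/
def IsClassS {T : ℝ} {O A : Set ℝ} (h : Icc (0 : ℝ) T × closure O × A → ℝ) : Prop :=
  Measurable h ∧ (∃ C : ℝ, ∀ p, |h p| ≤ C) ∧
    ∀ t, Continuous fun p : closure O × A => h (t, p)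

/-- A coefficient on `[0, T] × ℝ × A` restricted to `[0, T] × cl(O) × A`. -/
def restrictCoeff {T : ℝ} {O A : Set ℝ} (c : Icc (0 : ℝ) T × ℝ × A → ℝ) :
    Icc (0 : ℝ) T × closure O × A → ℝ :=
  fun p => c (p.1, (p.2.1 : ℝ), p.2.2)

/-- Measurable, bounded, and Lipschitz in `x` uniformly in `(t, a)`. -/
def IsRegularCoeff {T : ℝ} {A : Set ℝ} (c : Icc (0 : ℝ) T × ℝ × A → ℝ) : Prop :=
  Measurable c ∧ (∃ C : ℝ, ∀ p, |c p| ≤ C) ∧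
    ∃ L : ℝ, ∀ t x y a, |c (t, x, a) - c (t, y, a)| ≤ L * |x - y|

/-- The data of the single-agent problem: drift `b`, diffusion coefficient `σ`, rewards `f`, `g`,
and initial law `m₀`, a probability measure on `O`. -/
structure ProblemData (T : ℝ) (O A : Set ℝ) where
  b : Icc (0 : ℝ) T × ℝ × A → ℝ
  σ : Icc (0 : ℝ) T × ℝ × A → ℝ
  f : Icc (0 : ℝ) T × closure O × A → ℝ
  g : Icc (0 : ℝ) T × closure O → ℝ
  m₀ : ProbabilityMeasure O

/-- The standing assumption of the single-agent problem. -/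
structure SingleAgentAssumption {T : ℝ} {O A : Set ℝ} (D : ProblemData T O A) : Prop where
  b_regular : IsRegularCoeff D.b
  σ_regular : IsRegularCoeff D.σ
  σ_nonneg : ∀ p, 0 ≤ D.σ p
  b_classS : IsClassS (restrictCoeff (O := O) D.b)
  σ_classS : IsClassS (restrictCoeff (O := O) D.σ)
  f_measurable : Measurable D.f
  f_bounded : ∃ C : ℝ, ∀ p, |D.f p| ≤ C
  f_usc : ∀ t, UpperSemicontinuous fun p : closure O × A => D.f (t, p)
  g_usc : UpperSemicontinuous D.g
  g_bddAbove : BddAbove (range D.g)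
  m₀_log : Integrable (fun x : O => Real.log (1 + |(x : ℝ)|)) (D.m₀ : Measure O)

namespace ProblemData

variable {T : ℝ} {O A : Set ℝ} (D : ProblemData T O A)

/-- `∂_t u + ℒu`, where `ℒu(t, x, a) = b(t, x, a) ∂_x u(t, x) + (σ²/2)(t, x, a) ∂_xx u(t, x)`. -/
def generator (u : ℝ → ℝ → ℝ) (p : Icc (0 : ℝ) T × closure O × A) : ℝ :=
  timeDeriv T u p.1 p.2.1 +
    (D.b (p.1, (p.2.1 : ℝ), p.2.2) * spaceDeriv (closure O) u p.1 p.2.1 +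
      D.σ (p.1, (p.2.1 : ℝ), p.2.2) ^ 2 / 2 *
        spaceDeriv (closure O) (spaceDeriv (closure O) u) p.1 p.2.1)

/-- The constraint set `ℛ`. -/
def admissible :
    Set (ProbabilityMeasure (Icc (0 : ℝ) T × closure O) × PosFlow T (closure O × A)) :=
  {q | ∀ u : ℝ → ℝ → ℝ, IsCb12 T (closure O) u →
    ∫ p, u p.1 p.2 ∂(q.1 : Measure (Icc (0 : ℝ) T × closure O)) =
      ∫ x, u 0 x ∂(D.m₀ : Measure O) + q.2.1.integral (D.generator u)}

/-- `∫ g dμ ∈ ℝ ∪ {-∞}` as the integral of the positive part minus that of the negative part;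
for `g` bounded above and `μ` finite the first one is finite. -/
def terminalReward (μ : ProbabilityMeasure (Icc (0 : ℝ) T × closure O)) : EReal :=
  ((∫⁻ p, ENNReal.ofReal (D.g p) ∂(μ : Measure (Icc (0 : ℝ) T × closure O)) : ℝ≥0∞) : EReal) -
    ((∫⁻ p, ENNReal.ofReal (-D.g p) ∂(μ : Measure (Icc (0 : ℝ) T × closure O)) : ℝ≥0∞) : EReal)

/-- The objective `Γ(μ, m) = ∫₀ᵀ ∫ f(t, x, a) m_t(dx, da) dt + ∫ g dμ`. -/
def objective
    (q : ProbabilityMeasure (Icc (0 : ℝ) T × closure O) × PosFlow T (closure O × A)) : EReal :=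
  ((q.2.1.integral D.f : ℝ) : EReal) + D.terminalReward q.1

end ProblemData

end LPControl

end

/-!
The linear program has a solution by the direct method, in a topology strong enough in the time
variable to deal with coefficients and rewards that are merely measurable in `t`.

A positive flow is represented by a sub-Markov kernel `κ` from `[0, T]` to `cl(O) × A`, and
`∫₀ᵀ ∫ h dm_t dt` becomes an integral against `timeMeasure T ⊗ₘ κ`. Testing the constraint with
`u(t, x) = ∫₀ᵗ v` shows that an admissible flow satisfies `m_t(cl(O) × A) ≤ 1` for almost every `t`
(`ProblemData.ae_apply_univ_le_one`), so the two descriptions agree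
(`ProblemData.exists_kernel_of_mem_admissible`, `ProblemData.ofKernel_mem_admissible`). Testing it
with `u = χ(εx)` and `u = (T - t) χ(εx)`, where `χ(y) = y² / (1 + y²)`, shows that the admissible
pairs are uniformly tight (`ProblemData.exists_tight`). The set of admissible pairs is not empty,
because stopping at time `0` is admissible.

Compactness (`exists_seq_tendsto_fiberwiseTendsto`). Weak convergence of `timeMeasure T ⊗ₘ κₙ` would
not suffice to pass to the limit in `∫ f`, since `f` is only measurable in `t`. Fibrewise weak
convergence for almost every `t` is obtained by exploiting convexity. Let `(φⱼ)` be a countable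
family of continuous functions `E → [0, 1]` from which indicators of open sets are pointwise limits
from below, and embed kernels into `L²(dt ⊗ weights)` by `κ ↦ ((t, j) ↦ ∫ φⱼ dκ_t)`. In a decreasing
sequence of nonempty bounded convex subsets of a Hilbert space, elements of nearly minimal norm form
a convergent sequence (`exists_seq_mem_tendsto_of_midpoint`). Applied to the sublevel sets of the
cost, this gives a minimising sequence for which, along a subsequence, all `∫ φⱼ dκₙ(t)` converge
for almost every `t`. Prokhorov's theorem yields a weak limit of `timeMeasure T ⊗ₘ κₙ`;
disintegrating it gives a kernel `κ` with `lim ∫ φⱼ dκₙ(t) = ∫ φⱼ dκ(t)` for almost every `t` and every `j`,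
hence `κ(t)(U) ≤ liminf κₙ(t)(U)` for every open `U` (`exists_fiberwiseTendsto`).

With fibrewise convergence, the layer cake formula and Fatou's lemma on `[0, T]` give the
semicontinuity of the reward for `f` upper semicontinuous in `(x, a)`, and the continuity of the
constraint, whose integrand is continuous in `(x, a)`. Up to additive constants the reward is the
opposite of a cost with values in `[0, ∞]` (`ProblemData.objective_eq`), which is minimised in
`exists_minimizer_cost`.
-/

namespace LPControl

open Filter Topology ProbabilityTheory
open scoped NNReal

/-! ### Near-minimisers in nested convex sets of a Hilbert space -/

/-- In a decreasing sequence of nonempty, bounded, midpoint-closed subsets of a Hilbert space one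
can choose elements that form a convergent sequence: elements of nearly minimal norm are
Cauchy by the parallelogram law. -/
theorem exists_seq_mem_tendsto_of_midpoint {H : Type*} [NormedAddCommGroup H]
    [InnerProductSpace ℝ H] [CompleteSpace H] {C : ℕ → Set H} (hC : Antitone C)
    (hne : ∀ n, (C n).Nonempty)
    (hmid : ∀ n, ∀ x ∈ C n, ∀ y ∈ C n, (2⁻¹ : ℝ) • (x + y) ∈ C n)
    {R : ℝ} (hR : ∀ n, ∀ x ∈ C n, ‖x‖ ≤ R) :
    ∃ y : ℕ → H, (∀ n, y n ∈ C n) ∧ ∃ z, Tendsto y atTop (𝓝 z) := by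
  set d : ℕ → ℝ := fun n => sInf ((fun x => ‖x‖ ^ 2) '' C n) with hd
  have hbdd : ∀ n, BddBelow ((fun x : H => ‖x‖ ^ 2) '' C n) := fun n =>
    ⟨0, by rintro _ ⟨x, -, rfl⟩; positivity⟩
  have hdle : ∀ n, ∀ x ∈ C n, d n ≤ ‖x‖ ^ 2 := fun n x hx => csInf_le (hbdd n) ⟨x, hx, rfl⟩
  have hdmono : Monotone d := fun n m hnm =>
    csInf_le_csInf (hbdd n) ((hne m).image _) (image_mono (hC hnm))
  have hdbdd : BddAbove (range d) := by
    refine ⟨R ^ 2, ?_⟩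
    rintro _ ⟨n, rfl⟩
    obtain ⟨x, hx⟩ := hne n
    exact (hdle n x hx).trans (pow_le_pow_left₀ (norm_nonneg _) (hR n x hx) 2)
  have hdlim := tendsto_atTop_ciSup hdmono hdbdd
  set D := ⨆ n, d n
  have hdD : ∀ n, d n ≤ D := fun n => le_ciSup hdbdd n
  have hex : ∀ n : ℕ, ∃ y ∈ C n, ‖y‖ ^ 2 < d n + 1 / ((n : ℝ) + 1) := fun n => by
    obtain ⟨_, ⟨y, hy, rfl⟩, hlt⟩ := exists_lt_of_csInf_lt ((hne n).image (fun x => ‖x‖ ^ 2))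
      (lt_add_of_pos_right (d n) (Nat.one_div_pos_of_nat (α := ℝ) (n := n)))
    exact ⟨y, hy, hlt⟩
  choose y hyC hy using hex
  refine ⟨y, hyC, cauchySeq_tendsto_of_complete ?_⟩
  refine cauchySeq_of_le_tendsto_0 (fun N => √(4 * (D - d N) + 4 * (1 / ((N : ℝ) + 1)))) ?_ ?_
  · intro n m N hn hm
    refine Real.le_sqrt_of_sq_le ?_
    have hpar := parallelogram_law_with_norm ℝ (y n) (y m)
    have hlow := hdle N _ (hmid N _ (hC hn (hyC n)) _ (hC hm (hyC m)))
    rw [norm_smul, mul_pow] at hlow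
    norm_num at hlow
    have hεn : 1 / ((n : ℝ) + 1) ≤ 1 / ((N : ℝ) + 1) := Nat.one_div_le_one_div hn
    have hεm : 1 / ((m : ℝ) + 1) ≤ 1 / ((N : ℝ) + 1) := Nat.one_div_le_one_div hm
    have := hdD n
    have := hdD m
    have := hy n
    have := hy m
    rw [dist_eq_norm]
    nlinarith
  · have h1 : Tendsto (fun N : ℕ => 4 * (D - d N) + 4 * (1 / ((N : ℝ) + 1))) atTop
        (𝓝 (4 * (D - D) + 4 * 0)) :=
      ((hdlim.const_sub D).const_mul 4).add (tendsto_one_div_add_atTop_nhds_zero_nat.const_mul 4)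
    simpa using h1.sqrt

/-! ### A countable family of continuous functions approximating open sets -/

/-- A countable family of continuous functions with values in `[0, 1]`, containing the constant `1`,
such that the indicator of each open set is the pointwise limit from below of a sequence of members.
The family consists of the finite suprema of approximations of the indicators of basic open sets. -/
theorem exists_countable_family_tendsto_indicator (E : Type*) [TopologicalSpace E]
    [SecondCountableTopology E] [HasOuterApproxClosed E] :
    ∃ φ : ℕ → E → ℝ, (∀ j, Continuous (φ j)) ∧ (∀ j e, 0 ≤ φ j e) ∧ (∀ j e, φ j e ≤ 1) ∧
      (∃ j, ∀ e, φ j e = 1) ∧ ∀ U, IsOpen U → ∃ s : ℕ → ℕ,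
        (∀ k e, φ (s k) e ≤ U.indicator 1 e) ∧
        ∀ e, Tendsto (fun k => φ (s k) e) atTop (𝓝 (U.indicator 1 e)) := by
  classical
  let B := TopologicalSpace.countableBasis E
  have hBo : ∀ b : B, IsClosed (b : Set E)ᶜ := fun b =>
    (TopologicalSpace.isOpen_of_mem_countableBasis b.2).isClosed_compl
  have : Countable B := (TopologicalSpace.countable_countableBasis E).to_subtype
  let ψ : B × ℕ → E → ℝ≥0 := fun i e => 1 - (hBo i.1).apprSeq i.2 e
  have hψc : ∀ i, Continuous (ψ i) := fun i =>
    continuous_const.sub ((hBo i.1).apprSeq i.2).continuous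
  have hψ1 : ∀ i e, ψ i e ≤ 1 := fun i e => tsub_le_self
  have hψ0 : ∀ i e, e ∉ (i.1 : Set E) → ψ i e = 0 := fun i e he => by
    have : (hBo i.1).apprSeq i.2 e = 1 := HasOuterApproxClosed.apprSeq_apply_eq_one _ _ he
    simp [ψ, this]
  have hψlim : ∀ (b : B) e, e ∈ (b : Set E) → Tendsto (fun n => ψ (b, n) e) atTop (𝓝 1) := by
    intro b e he
    have h := (tendsto_pi_nhds.1 (HasOuterApproxClosed.tendsto_apprSeq (hBo b))) e
    rw [indicator_of_notMem (by simpa using he)] at h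
    simpa [ψ] using h.const_sub (1 : ℝ≥0)
  let Ψ : Option (Finset (B × ℕ)) → E → ℝ≥0 := fun o => o.elim 1 (fun S => S.sup ψ)
  have hΨs : ∀ (S : Finset (B × ℕ)) e, Ψ (some S) e = S.sup (fun i => ψ i e) := fun S e => by
    simp [Ψ, Finset.sup_apply]
  obtain ⟨enum, henum⟩ := exists_surjective_nat (Option (Finset (B × ℕ)))
  obtain ⟨g, hg⟩ := exists_injective_nat (B × ℕ)
  refine ⟨fun j e => Ψ (enum j) e, fun j => ?_, fun j e => NNReal.coe_nonneg _, fun j e => ?_,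
    ?_, ?_⟩
  · refine NNReal.continuous_coe.comp ?_
    cases enum j with
    | none => exact continuous_const
    | some S =>
      have : Ψ (some S) = fun e => S.sup (fun i => ψ i e) := funext (hΨs S)
      rw [this]
      exact Continuous.finset_sup_apply (fun i _ => hψc i)
  · have : Ψ (enum j) e ≤ 1 := by
      cases enum j with
      | none => exact le_rfl
      | some S => rw [hΨs]; exact Finset.sup_le fun i _ => hψ1 i e
    exact_mod_cast this
  · obtain ⟨j, hj⟩ := henum none
    exact ⟨j, fun e => by simp [hj, Ψ]⟩
  · intro U hU
    -- The supremum of the first `k` approximations that stay below the indicator of `U`.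
    let S : ℕ → Finset (B × ℕ) := fun k =>
      ((Set.finite_Iio k).preimage hg.injOn : (g ⁻¹' Iio k).Finite).toFinset.filter
        (fun i => (i.1 : Set E) ⊆ U)
    have hle : ∀ k e, ((Ψ (some (S k)) e : ℝ≥0) : ℝ) ≤ U.indicator 1 e := by
      intro k e
      by_cases he : e ∈ U
      · rw [indicator_of_mem he, hΨs]
        exact_mod_cast Finset.sup_le fun i _ => hψ1 i e
      · rw [indicator_of_notMem he, hΨs]
        have : (S k).sup (fun i => ψ i e) ≤ 0 := Finset.sup_le fun i hi =>
          (hψ0 i e fun h => he ((Finset.mem_filter.1 hi).2 h)).le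
        exact_mod_cast this
    choose s hs using fun k => henum (some (S k))
    refine ⟨s, fun k e => by simpa only [hs] using hle k e, fun e => ?_⟩
    simp only [hs]
    by_cases he : e ∈ U
    · obtain ⟨b, hb, heb, hbU⟩ :=
        (TopologicalSpace.isBasis_countableBasis E).exists_subset_of_mem_open he hU
      refine tendsto_order.2 ⟨fun a ha => ?_, fun a ha => ?_⟩
      · have hlim := (NNReal.tendsto_coe.2 (hψlim ⟨b, hb⟩ e heb))
        have ha' : a < ((1 : ℝ≥0) : ℝ) := by simpa [indicator_of_mem he] using ha
        obtain ⟨n, hn⟩ := (hlim.eventually (lt_mem_nhds ha')).exists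
        filter_upwards [eventually_gt_atTop (g (⟨b, hb⟩, n))] with k hk
        refine hn.trans_le ?_
        rw [hΨs]
        exact_mod_cast Finset.le_sup (f := fun i => ψ i e)
          (Finset.mem_filter.2 ⟨by simpa using hk, hbU⟩ : (⟨b, hb⟩, n) ∈ S k)
      · exact Eventually.of_forall fun k => (hle k e).trans_lt ha
    · have : ∀ k, ((Ψ (some (S k)) e : ℝ≥0) : ℝ) = U.indicator 1 e := fun k =>
        le_antisymm (hle k e) (by rw [indicator_of_notMem he]; exact NNReal.coe_nonneg _)
      simp only [this]
      exact tendsto_const_nhds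

/-! ### Sub-Markov kernels and fibrewise convergence -/

/-- A sub-Markov kernel: all its measures have mass at most `1`. -/
def IsSubMarkov {I E : Type*} [MeasurableSpace I] [MeasurableSpace E] (κ : Kernel I E) : Prop :=
  ∀ t, κ t univ ≤ 1

section SubMarkov

variable {I E : Type*} [MeasurableSpace I] [MeasurableSpace E] {κ : Kernel I E}

theorem IsSubMarkov.isFiniteKernel (hκ : IsSubMarkov κ) : IsFiniteKernel κ :=
  ⟨1, ENNReal.one_lt_top, hκ⟩

theorem IsSubMarkov.norm_integral_le (hκ : IsSubMarkov κ) {f : E → ℝ} {C : ℝ} (hC : 0 ≤ C)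
    (hf : ∀ e, |f e| ≤ C) (t : I) : |∫ e, f e ∂κ t| ≤ C := by
  have := hκ.isFiniteKernel
  have h := norm_integral_le_of_norm_le_const (μ := κ t) (f := f) (C := C)
    (Eventually.of_forall hf)
  exact h.trans (mul_le_of_le_one_right hC
    (ENNReal.toReal_le_of_le_ofReal zero_le_one (by simpa using hκ t)))

theorem IsSubMarkov.compProd_univ_le {κ : Kernel I E} (hκ : IsSubMarkov κ) (lam : Measure I)
    [IsFiniteMeasure lam] : (lam ⊗ₘ κ) univ ≤ lam univ := by
  have := hκ.isFiniteKernel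
  rw [Measure.compProd_apply MeasurableSet.univ]
  simpa using lintegral_mono (μ := lam) fun t => hκ t

theorem IsSubMarkov.integral_compProd_mul {κ : Kernel I E} (hκ : IsSubMarkov κ) {lam : Measure I}
    [IsFiniteMeasure lam] {ψ : I → ℝ} {φ : E → ℝ} (hψ : Measurable ψ) (hφ : Measurable φ)
    {C : ℝ} (hψC : ∀ t, |ψ t| ≤ C) (hφ1 : ∀ e, |φ e| ≤ 1) :
    ∫ z, ψ z.1 * φ z.2 ∂(lam ⊗ₘ κ) = ∫ t, ψ t * ∫ e, φ e ∂κ t ∂lam := by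
  have := hκ.isFiniteKernel
  rw [Measure.integral_compProd]
  · simp only [integral_const_mul]
  · refine Integrable.of_bound
      ((hψ.comp measurable_fst).mul (hφ.comp measurable_snd)).aestronglyMeasurable C
      (Eventually.of_forall fun z => ?_)
    rw [norm_mul]
    exact (mul_le_of_le_one_right (norm_nonneg _) (hφ1 z.2)).trans (hψC z.1)

end SubMarkov

/-- Two `[0, 1]`-valued densities with the same integrals against bounded continuous functions agree
almost everywhere. -/
theorem ae_eq_of_forall_integral_boundedContinuous_mul_eq {I : Type*} [TopologicalSpace I]
    [HasOuterApproxClosed I] [MeasurableSpace I] [BorelSpace I] {lam : Measure I}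
    [IsFiniteMeasure lam] {a b : I → ℝ} (ha : Measurable a) (hb : Measurable b)
    (ha0 : ∀ t, 0 ≤ a t) (hb0 : ∀ t, 0 ≤ b t) (ha1 : ∀ t, a t ≤ 1) (hb1 : ∀ t, b t ≤ 1)
    (h : ∀ ψ : BoundedContinuousFunction I ℝ, ∫ t, ψ t * a t ∂lam = ∫ t, ψ t * b t ∂lam) :
    a =ᵐ[lam] b := by
  have hfin : ∀ c : I → ℝ, (∀ t, c t ≤ 1) → ∫⁻ t, ENNReal.ofReal (c t) ∂lam ≠ ∞ := fun c hc =>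
    ((lintegral_mono fun t => ENNReal.ofReal_le_one.2 (hc t)).trans_lt
      (by simp [measure_lt_top])).ne
  have : IsFiniteMeasure (lam.withDensity fun t => ENNReal.ofReal (a t)) :=
    isFiniteMeasure_withDensity (hfin a ha1)
  have : IsFiniteMeasure (lam.withDensity fun t => ENNReal.ofReal (b t)) :=
    isFiniteMeasure_withDensity (hfin b hb1)
  have key : (lam.withDensity fun t => ENNReal.ofReal (a t)) =
      lam.withDensity fun t => ENNReal.ofReal (b t) := by
    refine ext_of_forall_integral_eq_of_IsFiniteMeasure fun ψ => ?_
    rw [integral_withDensity_eq_integral_toReal_smul ha.ennreal_ofReal (by simp),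
      integral_withDensity_eq_integral_toReal_smul hb.ennreal_ofReal (by simp)]
    simpa [ENNReal.toReal_ofReal, ha0, hb0, mul_comm] using h ψ
  rw [withDensity_eq_iff ha.ennreal_ofReal.aemeasurable hb.ennreal_ofReal.aemeasurable
    (hfin a ha1)] at key
  filter_upwards [key] with t ht
  exact (ENNReal.ofReal_eq_ofReal_iff (ha0 t) (hb0 t)).1 ht

/-- Disintegration along a first marginal whose density with respect to `lam` is at most `1`. -/
theorem exists_isSubMarkov_compProd_eq {I E : Type*} [MeasurableSpace I] [MeasurableSpace E]
    [StandardBorelSpace E] {lam : Measure I} [IsFiniteMeasure lam] {M : Measure (I × E)}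
    [IsFiniteMeasure M] {ℓ : I → ℝ≥0∞} (hℓ : Measurable ℓ) (hℓ1 : ∀ t, ℓ t ≤ 1)
    (hM : M.fst = lam.withDensity ℓ) : ∃ κ : Kernel I E, IsSubMarkov κ ∧ lam ⊗ₘ κ = M := by
  rcases isEmpty_or_nonempty E with hE | hE
  · exact ⟨0, fun t => by simp, by simp [Measure.eq_zero_of_isEmpty M]⟩
  let κ : Kernel I E := ⟨fun t => ℓ t • M.condKernel t, by
    refine Measure.measurable_of_measurable_coe _ fun s hs => ?_
    exact hℓ.mul (Kernel.measurable_coe M.condKernel hs)⟩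
  have hκ : ∀ t, κ t = ℓ t • M.condKernel t := fun t => rfl
  have hsub : IsSubMarkov κ := fun t => by simpa [hκ] using hℓ1 t
  have := hsub.isFiniteKernel
  refine ⟨κ, hsub, Measure.ext fun s hs => ?_⟩
  conv_rhs => rw [← M.disintegrate M.condKernel, Measure.compProd_apply hs, hM,
    lintegral_withDensity_eq_lintegral_mul _ hℓ (Kernel.measurable_kernel_prodMk_left hs)]
  rw [Measure.compProd_apply hs]
  simp [hκ]

/-- For `lam`-almost every `t`, the finite measures `κs n t` converge weakly to `κ t`, in the form
of the lower bound on open sets together with convergence of the masses. -/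
def FiberwiseTendsto {I E : Type*} [MeasurableSpace I] [MeasurableSpace E] [TopologicalSpace E]
    (lam : Measure I) (κs : ℕ → Kernel I E) (κ : Kernel I E) : Prop :=
  ∀ᵐ t ∂lam, (∀ U, IsOpen U → κ t U ≤ liminf (fun n => κs n t U) atTop) ∧
    Tendsto (fun n => κs n t univ) atTop (𝓝 (κ t univ))

/-- A set of pairs of a measure and a kernel that contains the midpoint of any two of its elements.
Kernels are not scaled by `ℝ≥0∞`, so the midpoint of two kernels is described pointwise. -/
def IsMidpointClosed {X I E : Type*} [MeasurableSpace X] [MeasurableSpace I] [MeasurableSpace E]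
    (P : Set (Measure X × Kernel I E)) : Prop :=
  ∀ p ∈ P, ∀ q ∈ P, ∃ r ∈ P, r.1 = (2⁻¹ : ℝ≥0∞) • (p.1 + q.1) ∧
    ∀ t, r.2 t = (2⁻¹ : ℝ≥0∞) • (p.2 t + q.2 t)

section Extraction

variable {X I E : Type*} [MeasurableSpace X] [MeasurableSpace I] [MeasurableSpace E]

/-- From a decreasing sequence of convex sets of kernels one can choose elements whose integrals
against countably many bounded functions all converge, for almost every `t`. The kernels are mapped
to the Hilbert space `L²(lam ⊗ w)` by `κ ↦ ((t, j) ↦ ∫ φⱼ dκ_t)`, with `w` a finite measure charging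
every integer. -/
theorem exists_seq_ae_tendsto_integral {lam : Measure I} [IsFiniteMeasure lam]
    {φ : ℕ → E → ℝ} (hφ : ∀ j, Measurable (φ j)) (hφ1 : ∀ j e, |φ j e| ≤ 1)
    {P : ℕ → Set (Measure X × Kernel I E)} (hP : Antitone P) (hne : ∀ n, (P n).Nonempty)
    (hmid : ∀ n, IsMidpointClosed (P n)) (hsub : ∀ n, ∀ p ∈ P n, IsSubMarkov p.2) :
    ∃ q : ℕ → Measure X × Kernel I E, ∃ s : ℕ → ℕ, StrictMono s ∧ (∀ n, q n ∈ P (s n)) ∧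
      ∀ᵐ t ∂lam, ∀ j, ∃ c, Tendsto (fun n => ∫ e, φ j e ∂((q n).2 t)) atTop (𝓝 c) := by
  let w : Measure ℕ := (Measure.count : Measure ℕ).toFinite
  let F : Measure X × Kernel I E → I × ℕ → ℝ := fun p z => ∫ e, φ z.2 e ∂(p.2 z.1)
  have hFm : ∀ p, Measurable (F p) := fun p =>
    measurable_from_prod_countable_left fun j =>
      ((hφ j).stronglyMeasurable.integral_kernel (κ := p.2)).measurable
  have hF1 : ∀ n, ∀ p ∈ P n, ∀ z, |F p z| ≤ 1 := fun n p hp z =>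
    (hsub n p hp).norm_integral_le zero_le_one (hφ1 z.2) z.1
  have hFL : ∀ n, ∀ p ∈ P n, MemLp (F p) 2 (lam.prod w) := fun n p hp =>
    MemLp.of_bound (hFm p).aestronglyMeasurable 1 (Eventually.of_forall (hF1 n p hp))
  let C : ℕ → Set (Lp ℝ 2 (lam.prod w)) := fun n => {y | ∃ p ∈ P n, y =ᵐ[lam.prod w] F p}
  obtain ⟨y, hyC, z, hz⟩ := exists_seq_mem_tendsto_of_midpoint (C := C)
    (R := ((measureUnivNNReal (lam.prod w) : ℝ≥0) : ℝ) ^ (2 : ℝ≥0∞).toReal⁻¹ * 1)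
    (fun n m hnm y ⟨p, hp, hy⟩ => ⟨p, hP hnm hp, hy⟩)
    (fun n => by
      obtain ⟨p, hp⟩ := hne n
      exact ⟨(hFL n p hp).toLp, p, hp, (hFL n p hp).coeFn_toLp⟩)
    (fun n => by
      rintro x ⟨p, hp, hx⟩ y ⟨q, hq, hy⟩
      obtain ⟨r, hr, -, hr2⟩ := hmid n p hp q hq
      refine ⟨r, hr, ?_⟩
      filter_upwards [Lp.coeFn_smul (2⁻¹ : ℝ) (x + y), Lp.coeFn_add x y, hx, hy]
        with u h1 h2 h3 h4
      have := (hsub n p hp).isFiniteKernel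
      have := (hsub n q hq).isFiniteKernel
      have hint : ∀ (κ : Kernel I E) [IsFiniteKernel κ], Integrable (φ u.2) (κ u.1) := fun κ _ =>
        Integrable.of_bound (hφ u.2).aestronglyMeasurable 1 (Eventually.of_forall (hφ1 u.2))
      simp only [h1, h2, Pi.smul_apply, Pi.add_apply, h3, h4, F, hr2, integral_smul_measure]
      rw [integral_add_measure (hint p.2) (hint q.2)]
      simp)
    (fun n => by
      rintro x ⟨p, hp, hx⟩
      refine Lp.norm_le_of_ae_bound zero_le_one ?_
      filter_upwards [hx] with u hu
      rw [hu]
      exact hF1 n p hp u)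
  choose p hpP hyp using hyC
  obtain ⟨s, hs, hlim⟩ := (tendstoInMeasure_of_tendsto_Lp hz).exists_seq_tendsto_ae
  refine ⟨fun n => p (s n), s, hs, fun n => hpP (s n), ?_⟩
  have hall : ∀ᵐ u ∂(lam.prod w), Tendsto (fun n => F (p (s n)) u) atTop (𝓝 (z u)) := by
    filter_upwards [hlim, ae_all_iff.2 fun n => hyp (s n)] with u h1 h2
    simpa only [h2] using h1
  filter_upwards [Measure.ae_ae_of_ae_prod hall] with t ht j
  rw [ae_toFinite, Measure.ae_count_iff] at ht
  exact ⟨_, ht j⟩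

end Extraction

/-! ### Compactness of tight families of measure–kernel pairs -/

section Identification

variable {I E : Type*} [MeasurableSpace I] [MeasurableSpace E] [TopologicalSpace I]
  [TopologicalSpace E]

variable [BorelSpace I] [BorelSpace E]

/-- If `∫ φ dκₙ(t)` converges for almost every `t`, and `lam ⊗ₘ κₙ` converges weakly to `M` along an
ultrafilter, then the limit `a` is determined by `M`: `a dlam` is the first marginal of `φ dM`. -/
theorem exists_limit_integral_eq {lam : Measure I} [IsFiniteMeasure lam]
    {κs : ℕ → Kernel I E} (hκs : ∀ n, IsSubMarkov (κs n)) {M : Measure (I × E)}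
    {U : Ultrafilter ℕ} (hU : (U : Filter ℕ) ≤ atTop) {φ : E → ℝ} (hφ : Continuous φ)
    (hφ0 : ∀ e, 0 ≤ φ e) (hφ1 : ∀ e, φ e ≤ 1)
    (hM : ∀ f : BoundedContinuousFunction (I × E) ℝ,
      Tendsto (fun n => ∫ z, f z ∂(lam ⊗ₘ κs n)) U (𝓝 (∫ z, f z ∂M)))
    (hlim : ∀ᵐ t ∂lam, ∃ c, Tendsto (fun n => ∫ e, φ e ∂(κs n t)) atTop (𝓝 c)) :
    ∃ a : I → ℝ, Measurable a ∧ (∀ t, 0 ≤ a t) ∧ (∀ t, a t ≤ 1) ∧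
      (∀ᵐ t ∂lam, Tendsto (fun n => ∫ e, φ e ∂(κs n t)) atTop (𝓝 (a t))) ∧
      ∀ ψ : BoundedContinuousFunction I ℝ,
        ∫ t, ψ t * a t ∂lam = ∫ z, ψ z.1 * φ z.2 ∂M := by
  have habs : ∀ e, |φ e| ≤ 1 := fun e => abs_le.2 ⟨by linarith [hφ0 e], hφ1 e⟩
  have hm : ∀ n, Measurable fun t => ∫ e, φ e ∂(κs n t) := fun n =>
    (hφ.measurable.stronglyMeasurable.integral_kernel (κ := κs n)).measurable
  obtain ⟨a₀, ha₀, hlim₀⟩ := measurable_limit_of_tendsto_metrizable_ae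
    (fun n => (hm n).aemeasurable) hlim
  -- The measurable limit is truncated so that the bounds hold everywhere.
  have hlima : ∀ᵐ t ∂lam, Tendsto (fun n => ∫ e, φ e ∂(κs n t)) atTop
      (𝓝 (max 0 (min (a₀ t) 1))) := by
    filter_upwards [hlim₀] with t ht
    have h0 : 0 ≤ a₀ t := ge_of_tendsto' ht fun n => integral_nonneg hφ0
    have h1 : a₀ t ≤ 1 := le_of_tendsto' ht fun n =>
      (le_abs_self _).trans ((hκs n).norm_integral_le zero_le_one habs t)
    rwa [min_eq_left h1, max_eq_right h0]
  refine ⟨fun t => max 0 (min (a₀ t) 1), measurable_const.max (ha₀.min measurable_const),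
    fun t => le_max_left _ _, fun t => max_le zero_le_one (min_le_right _ _), hlima, fun ψ => ?_⟩
  have hψ : ∀ t, |ψ t| ≤ ‖ψ‖ := fun t => ψ.norm_coe_le_norm t
  have h1 : Tendsto (fun n => ∫ t, ψ t * ∫ e, φ e ∂(κs n t) ∂lam) atTop
      (𝓝 (∫ t, ψ t * max 0 (min (a₀ t) 1) ∂lam)) := by
    refine tendsto_integral_of_dominated_convergence (fun _ => ‖ψ‖)
      (fun n => (ψ.continuous.measurable.mul (hm n)).aestronglyMeasurable)
      (integrable_const _) (fun n => Eventually.of_forall fun t => ?_) ?_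
    · rw [norm_mul]
      exact (mul_le_of_le_one_right (norm_nonneg _)
        ((hκs n).norm_integral_le zero_le_one habs t)).trans (hψ t)
    · filter_upwards [hlima] with t ht
      exact ht.const_mul _
  let f : BoundedContinuousFunction (I × E) ℝ := BoundedContinuousFunction.ofNormedAddCommGroup
    (fun z => ψ z.1 * φ z.2) (by fun_prop) ‖ψ‖ fun z => by
      rw [norm_mul]
      exact (mul_le_of_le_one_right (norm_nonneg _) (habs z.2)).trans (hψ z.1)
  have h2 := hM f
  simp only [f, BoundedContinuousFunction.coe_ofNormedAddCommGroup] at h2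
  simp only [fun n => (hκs n).integral_compProd_mul (lam := lam) ψ.continuous.measurable
    hφ.measurable hψ habs] at h2
  exact tendsto_nhds_unique (h1.mono_left hU) h2

/-- A tight sequence of sub-Markov kernels along which the integrals of all functions of an
approximating countable family converge almost everywhere has a fibrewise limit. A weak limit `M` of
`lam ⊗ₘ κₙ` exists by Prokhorov's theorem, and the limit kernel is a disintegration of `M`. -/
theorem exists_fiberwiseTendsto [PolishSpace E] [PolishSpace I]
    {lam : Measure I} [IsFiniteMeasure lam]
    {κs : ℕ → Kernel I E} (hκs : ∀ n, IsSubMarkov (κs n))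
    {φ : ℕ → E → ℝ} (hφ : ∀ j, Continuous (φ j)) (hφ0 : ∀ j e, 0 ≤ φ j e)
    (hφ1 : ∀ j e, φ j e ≤ 1) (hone : ∃ j, ∀ e, φ j e = 1)
    (hind : ∀ U, IsOpen U → ∃ s : ℕ → ℕ, (∀ k e, φ (s k) e ≤ U.indicator 1 e) ∧
      ∀ e, Tendsto (fun k => φ (s k) e) atTop (𝓝 (U.indicator 1 e)))
    (hlim : ∀ᵐ t ∂lam, ∀ j, ∃ c, Tendsto (fun n => ∫ e, φ j e ∂(κs n t)) atTop (𝓝 c))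
    {K : ℕ → Set (I × E)} (hK : ∀ k, IsCompact (K k)) {u : ℕ → ℝ≥0}
    (hu : Tendsto u atTop (𝓝 0)) (hKu : ∀ n k, (lam ⊗ₘ κs n) (K k)ᶜ ≤ u k) :
    ∃ κ : Kernel I E, IsSubMarkov κ ∧ FiberwiseTendsto lam κs κ := by
  have : ∀ n, IsFiniteKernel (κs n) := fun n => (hκs n).isFiniteKernel
  let Ms : ℕ → FiniteMeasure (I × E) := fun n => ⟨lam ⊗ₘ κs n, inferInstance⟩
  have hcomp := isCompact_setOfPred_finiteMeasure_mass_le_compl_isCompact_le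
    (lam univ).toNNReal hu hK (Or.inl inferInstance)
  have hMs : ∀ n, Ms n ∈ {μ : FiniteMeasure (I × E) |
      μ.mass ≤ (lam univ).toNNReal ∧ ∀ n, μ (K n)ᶜ ≤ u n} := fun n =>
    ⟨ENNReal.toNNReal_mono (measure_ne_top _ _) ((hκs n).compProd_univ_le lam), fun k =>
      (ENNReal.toNNReal_mono ENNReal.coe_ne_top (hKu n k)).trans_eq (ENNReal.toNNReal_coe _)⟩
  -- An ultrafilter replaces a subsequence: no metrizability of `FiniteMeasure` is needed, and the
  -- fibrewise limits exist along the whole sequence anyway.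
  let U : Ultrafilter ℕ := hyperfilter ℕ
  have hU : (U : Filter ℕ) ≤ atTop := Nat.hyperfilter_le_atTop
  obtain ⟨M, -, hM⟩ := hcomp.ultrafilter_le_nhds' (U.map Ms)
    (Ultrafilter.mem_map.2 (univ_mem' hMs))
  have hM' : ∀ f : BoundedContinuousFunction (I × E) ℝ,
      Tendsto (fun n => ∫ z, f z ∂(lam ⊗ₘ κs n)) U (𝓝 (∫ z, f z ∂(M : Measure (I × E)))) :=
    FiniteMeasure.tendsto_iff_forall_integral_tendsto.1 (hM : Tendsto Ms U (𝓝 M))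
  have hlimit := fun j => exists_limit_integral_eq hκs hU (hφ j) (hφ0 j) (hφ1 j) hM'
    (hlim.mono fun t ht => ht j)
  choose a ha ha0 ha1 hat haψ using hlimit
  obtain ⟨j₀, hj₀⟩ := hone
  -- The constant function of the family identifies the first marginal of `M`.
  have hfst : (M : Measure (I × E)).fst = lam.withDensity fun t => ENNReal.ofReal (a j₀ t) := by
    have : IsFiniteMeasure (lam.withDensity fun t => ENNReal.ofReal (a j₀ t)) :=
      isFiniteMeasure_withDensity ((lintegral_mono fun t =>
        ENNReal.ofReal_le_one.2 (ha1 j₀ t)).trans_lt (by simp [measure_lt_top])).ne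
    refine ext_of_forall_integral_eq_of_IsFiniteMeasure fun ψ => ?_
    rw [integral_withDensity_eq_integral_toReal_smul (ha j₀).ennreal_ofReal (by simp),
      Measure.fst, integral_map measurable_fst.aemeasurable
        ψ.continuous.measurable.aestronglyMeasurable]
    have := haψ j₀ ψ
    simp only [hj₀, mul_one] at this
    simpa [ENNReal.toReal_ofReal, ha0, mul_comm] using this.symm
  obtain ⟨κ, hκ, hκM⟩ := exists_isSubMarkov_compProd_eq (ha j₀).ennreal_ofReal
    (fun t => ENNReal.ofReal_le_one.2 (ha1 j₀ t)) hfst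
  have := hκ.isFiniteKernel
  have habs : ∀ j e, |φ j e| ≤ 1 := fun j e => abs_le.2 ⟨by linarith [hφ0 j e], hφ1 j e⟩
  have hident : ∀ᵐ t ∂lam, ∀ j, Tendsto (fun n => ∫ e, φ j e ∂(κs n t)) atTop
      (𝓝 (∫ e, φ j e ∂κ t)) := by
    refine ae_all_iff.2 fun j => ?_
    have hae : a j =ᵐ[lam] fun t => ∫ e, φ j e ∂κ t := by
      refine ae_eq_of_forall_integral_boundedContinuous_mul_eq (ha j)
        ((hφ j).measurable.stronglyMeasurable.integral_kernel (κ := κ)).measurable (ha0 j)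
        (fun t => integral_nonneg (hφ0 j)) (ha1 j)
        (fun t => (le_abs_self _).trans (hκ.norm_integral_le zero_le_one (habs j) t)) fun ψ => ?_
      rw [haψ, ← hκM]
      exact hκ.integral_compProd_mul ψ.continuous.measurable (hφ j).measurable
        (fun t => ψ.norm_coe_le_norm t) (habs j)
    filter_upwards [hat j, hae] with t h1 h2
    rwa [← h2]
  refine ⟨κ, hκ, ?_⟩
  have hint : ∀ (m : Measure E) [IsFiniteMeasure m] j, Integrable (φ j) m := fun m _ j =>
    Integrable.of_bound (hφ j).measurable.aestronglyMeasurable 1 (Eventually.of_forall (habs j))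
  filter_upwards [hident] with t ht
  have hreal : ∀ (m : Measure E) [IsFiniteMeasure m] j,
      ∫⁻ e, ENNReal.ofReal (φ j e) ∂m = ENNReal.ofReal (∫ e, φ j e ∂m) := fun m _ j =>
    (ofReal_integral_eq_lintegral_ofReal (hint m j) (Eventually.of_forall (hφ0 j))).symm
  have ht' : ∀ j, Tendsto (fun n => ∫⁻ e, ENNReal.ofReal (φ j e) ∂(κs n t)) atTop
      (𝓝 (∫⁻ e, ENNReal.ofReal (φ j e) ∂κ t)) := fun j => by
    simp only [hreal]
    exact ENNReal.tendsto_ofReal (ht j)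
  have hindle : ∀ (V : Set E) (m : Measure E) j, MeasurableSet V →
      (∀ e, φ j e ≤ V.indicator 1 e) → ∫⁻ e, ENNReal.ofReal (φ j e) ∂m ≤ m V := by
    intro V m j hV hj
    rw [← lintegral_indicator_one hV]
    refine lintegral_mono fun e => ?_
    refine (ENNReal.ofReal_le_ofReal (hj e)).trans ?_
    by_cases he : e ∈ V <;> simp [he]
  refine ⟨fun V hV => ?_, by simpa [hj₀] using ht' j₀⟩
  obtain ⟨s, hs1, hs2⟩ := hind V hV
  have hconv : Tendsto (fun k => ∫⁻ e, ENNReal.ofReal (φ (s k) e) ∂κ t) atTop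
      (𝓝 (∫⁻ e, V.indicator 1 e ∂κ t)) := by
    refine tendsto_lintegral_of_dominated_convergence (fun _ => 1)
      (fun k => (hφ _).measurable.ennreal_ofReal)
      (fun k => Eventually.of_forall fun e => ENNReal.ofReal_le_one.2 (hφ1 _ e))
      (by simp [measure_ne_top]) (Eventually.of_forall fun e => ?_)
    have := ENNReal.tendsto_ofReal (hs2 e)
    by_cases he : e ∈ V <;> simpa [he] using this
  rw [lintegral_indicator_one hV.measurableSet] at hconv
  refine le_of_tendsto' hconv fun k => ?_
  rw [← (ht' (s k)).liminf_eq]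
  exact liminf_le_liminf (Eventually.of_forall fun n => hindle V _ _ hV.measurableSet (hs1 k))

/-- From a decreasing sequence of nonempty, midpoint-closed, uniformly tight sets of pairs of a
probability measure and a sub-Markov kernel one can extract a sequence that converges weakly in the
first and fibrewise in the second component. -/
theorem exists_seq_tendsto_fiberwiseTendsto {X : Type*} [MeasurableSpace X] [TopologicalSpace X]
    [BorelSpace X] [PolishSpace X] [PolishSpace E] [PolishSpace I]
    {lam : Measure I} [IsFiniteMeasure lam]
    {P : ℕ → Set (Measure X × Kernel I E)} (hP : Antitone P) (hne : ∀ n, (P n).Nonempty)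
    (hmid : ∀ n, IsMidpointClosed (P n)) (hprob : ∀ n, ∀ p ∈ P n, IsProbabilityMeasure p.1)
    (hsub : ∀ n, ∀ p ∈ P n, IsSubMarkov p.2)
    {K : ℕ → Set X} (hK : ∀ k, IsCompact (K k)) {K' : ℕ → Set (I × E)}
    (hK' : ∀ k, IsCompact (K' k)) {u : ℕ → ℝ≥0} (hu : Tendsto u atTop (𝓝 0))
    (hKu : ∀ n, ∀ p ∈ P n, ∀ k, p.1 (K k)ᶜ ≤ u k)
    (hKu' : ∀ n, ∀ p ∈ P n, ∀ k, (lam ⊗ₘ p.2) (K' k)ᶜ ≤ u k) :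
    ∃ (μs : ℕ → ProbabilityMeasure X) (κs : ℕ → Kernel I E) (s : ℕ → ℕ)
      (μ : ProbabilityMeasure X) (κ : Kernel I E), StrictMono s ∧
      (∀ n, ((μs n : Measure X), κs n) ∈ P (s n)) ∧ Tendsto μs atTop (𝓝 μ) ∧ IsSubMarkov κ ∧
      FiberwiseTendsto lam κs κ := by
  obtain ⟨φ, hφ, hφ0, hφ1, hone, hind⟩ := exists_countable_family_tendsto_indicator E
  have habs : ∀ j e, |φ j e| ≤ 1 := fun j e => abs_le.2 ⟨by linarith [hφ0 j e], hφ1 j e⟩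
  obtain ⟨q, s, hs, hq, hlim⟩ := exists_seq_ae_tendsto_integral (lam := lam)
    (fun j => (hφ j).measurable) habs hP hne hmid hsub
  let ρ : ℕ → ProbabilityMeasure X := fun n => ⟨(q n).1, hprob _ _ (hq n)⟩
  have hcomp := isCompact_setOfPred_probabilityMeasure_mass_eq_compl_isCompact_le
    hu hK (Or.inl inferInstance)
  obtain ⟨μ, -, r, hr, hμ⟩ := hcomp.tendsto_subseq (x := ρ) fun n k =>
    (ENNReal.toNNReal_mono ENNReal.coe_ne_top (hKu _ _ (hq n) k)).trans_eq (ENNReal.toNNReal_coe _)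
  obtain ⟨κ, hκ, hκlim⟩ := exists_fiberwiseTendsto (lam := lam) (κs := fun n => (q (r n)).2)
    (fun n => hsub _ _ (hq _)) hφ hφ0 hφ1 hone hind
    (hlim.mono fun t ht j => (ht j).imp fun c hc => hc.comp hr.tendsto_atTop) hK' hu
    (fun n k => hKu' _ _ (hq _) k)
  exact ⟨ρ ∘ r, fun n => (q (r n)).2, s ∘ r, μ, κ, hs.comp hr, fun n => hq (r n), hμ, hκ, hκlim⟩

end Identification

/-! ### Lower semicontinuity and minimisation of the cost -/

/-- Layer cake formula and Fatou's lemma, the superlevel sets being open. -/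
theorem lintegral_le_liminf_lintegral_of_lowerSemicontinuous {E : Type*} [MeasurableSpace E]
    [TopologicalSpace E] [OpensMeasurableSpace E] {m : Measure E} {ms : ℕ → Measure E} {f : E → ℝ}
    (hf : LowerSemicontinuous f) (hf0 : ∀ e, 0 ≤ f e)
    (h : ∀ U, IsOpen U → m U ≤ liminf (fun n => ms n U) atTop) :
    ∫⁻ e, ENNReal.ofReal (f e) ∂m ≤
      liminf (fun n => ∫⁻ e, ENNReal.ofReal (f e) ∂(ms n)) atTop := by
  simp_rw [lintegral_eq_lintegral_meas_lt _ (Eventually.of_forall hf0) hf.measurable.aemeasurable]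
  refine (lintegral_mono fun t => h _ (hf.isOpen_preimage t)).trans
    (lintegral_liminf_le fun n => ?_)
  exact Antitone.measurable fun s t hst => measure_mono fun e he => lt_of_le_of_lt hst he

section Continuity

variable {I E : Type*} [MeasurableSpace I] [MeasurableSpace E] [TopologicalSpace E]
  {lam : Measure I} [IsFiniteMeasure lam] {κs : ℕ → Kernel I E} {κ : Kernel I E}

theorem FiberwiseTendsto.tendsto_measureReal_univ (h : FiberwiseTendsto lam κs κ)
    (hκs : ∀ n, IsSubMarkov (κs n)) (hκ : IsSubMarkov κ) :
    Tendsto (fun n => (lam ⊗ₘ κs n).real univ) atTop (𝓝 ((lam ⊗ₘ κ).real univ)) := by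
  have := hκ.isFiniteKernel
  have := fun n => (hκs n).isFiniteKernel
  refine (ENNReal.tendsto_toReal (measure_ne_top _ _)).comp ?_
  simp_rw [Measure.compProd_apply MeasurableSet.univ, preimage_univ]
  exact tendsto_lintegral_of_dominated_convergence (fun _ => 1)
    (fun n => Kernel.measurable_coe _ MeasurableSet.univ)
    (fun n => Eventually.of_forall (hκs n)) (by simp [measure_ne_top])
    (h.mono fun t ht => ht.2)

variable [BorelSpace E]

theorem FiberwiseTendsto.lintegral_le_liminf (h : FiberwiseTendsto lam κs κ)
    (hκs : ∀ n, IsSubMarkov (κs n)) (hκ : IsSubMarkov κ) {f : I × E → ℝ} (hf : Measurable f)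
    (hf0 : ∀ z, 0 ≤ f z) (hlsc : ∀ t, LowerSemicontinuous fun e => f (t, e)) :
    ∫⁻ z, ENNReal.ofReal (f z) ∂(lam ⊗ₘ κ) ≤
      liminf (fun n => ∫⁻ z, ENNReal.ofReal (f z) ∂(lam ⊗ₘ κs n)) atTop := by
  have := hκ.isFiniteKernel
  have := fun n => (hκs n).isFiniteKernel
  simp_rw [Measure.lintegral_compProd hf.ennreal_ofReal]
  refine le_trans (lintegral_mono_ae ?_)
    (lintegral_liminf_le fun n => hf.ennreal_ofReal.lintegral_kernel_prod_right')
  filter_upwards [h] with t ht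
  exact lintegral_le_liminf_lintegral_of_lowerSemicontinuous (hlsc t) (fun e => hf0 _) ht.1

theorem FiberwiseTendsto.eventually_integral_lt (h : FiberwiseTendsto lam κs κ)
    (hκs : ∀ n, IsSubMarkov (κs n)) (hκ : IsSubMarkov κ) {f : I × E → ℝ} (hf : Measurable f)
    {C : ℝ} (hC : ∀ z, |f z| ≤ C) (husc : ∀ t, UpperSemicontinuous fun e => f (t, e))
    {a : ℝ} (ha : ∫ z, f z ∂(lam ⊗ₘ κ) < a) :
    ∀ᶠ n in atTop, ∫ z, f z ∂(lam ⊗ₘ κs n) < a := by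
  have hf0 : ∀ z, 0 ≤ C - f z := fun z => sub_nonneg.2 ((le_abs_self _).trans (hC z))
  have hint : ∀ {κ : Kernel I E}, IsSubMarkov κ → Integrable f (lam ⊗ₘ κ) := fun {κ} hκ => by
    have := hκ.isFiniteKernel
    exact Integrable.of_bound hf.aestronglyMeasurable C (Eventually.of_forall hC)
  have heq : ∀ {κ : Kernel I E}, IsSubMarkov κ → ∫ z, (C - f z) ∂(lam ⊗ₘ κ) =
      (lam ⊗ₘ κ).real univ * C - ∫ z, f z ∂(lam ⊗ₘ κ) := fun {κ} hκ => by
    have := hκ.isFiniteKernel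
    rw [integral_sub (integrable_const _) (hint hκ), integral_const, smul_eq_mul]
  have hreal : ∀ {κ : Kernel I E}, IsSubMarkov κ → ∫⁻ z, ENNReal.ofReal (C - f z) ∂(lam ⊗ₘ κ) =
      ENNReal.ofReal (∫ z, (C - f z) ∂(lam ⊗ₘ κ)) := fun {κ} hκ => by
    have := hκ.isFiniteKernel
    exact (ofReal_integral_eq_lintegral_ofReal ((integrable_const _).sub (hint hκ))
      (Eventually.of_forall hf0)).symm
  have hlsc := h.lintegral_le_liminf hκs hκ (f := fun z => C - f z) (measurable_const.sub hf) hf0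
    (fun t y x hx => by
      filter_upwards [husc t y (C - x) (by linarith)] with e he
      linarith)
  -- `∫ f = C * mass - ∫ (C - f)`; an error `δ` is allowed in each of the two terms.
  obtain ⟨δ, hδ, hδa⟩ : ∃ δ > 0, ∫ z, f z ∂(lam ⊗ₘ κ) + 2 * δ = a :=
    ⟨(a - ∫ z, f z ∂(lam ⊗ₘ κ)) / 2, by linarith, by ring⟩
  have hlow : ∀ᶠ n in atTop, ∫ z, (C - f z) ∂(lam ⊗ₘ κ) - δ < ∫ z, (C - f z) ∂(lam ⊗ₘ κs n) := by
    rcases (integral_nonneg (μ := lam ⊗ₘ κ) (f := fun z => C - f z) hf0).eq_or_lt with h0 | h0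
    -- If the limit vanishes, `ENNReal.ofReal` would truncate the left-hand side to `0`.
    · refine Eventually.of_forall fun n => ?_
      have h0' : 0 = ∫ z, (C - f z) ∂(lam ⊗ₘ κ) := h0
      have : 0 ≤ ∫ z, (C - f z) ∂(lam ⊗ₘ κs n) := integral_nonneg hf0
      linarith
    · have hlt : ENNReal.ofReal (∫ z, (C - f z) ∂(lam ⊗ₘ κ) - δ) <
          liminf (fun n => ∫⁻ z, ENNReal.ofReal (C - f z) ∂(lam ⊗ₘ κs n)) atTop := by
        refine lt_of_lt_of_le ?_ hlsc
        rw [hreal hκ]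
        exact (ENNReal.ofReal_lt_ofReal_iff h0).2 (sub_lt_self _ hδ)
      filter_upwards [eventually_lt_of_lt_liminf hlt] with n hn
      rw [hreal (hκs n)] at hn
      exact (ENNReal.ofReal_lt_ofReal_iff'.1 hn).1
  have hmass := ((h.tendsto_measureReal_univ hκs hκ).mul_const C).eventually
    (gt_mem_nhds (lt_add_of_pos_right _ hδ))
  filter_upwards [hlow, hmass] with n h1 h2
  rw [heq hκ, heq (hκs n)] at h1
  linarith

theorem FiberwiseTendsto.tendsto_integral (h : FiberwiseTendsto lam κs κ)
    (hκs : ∀ n, IsSubMarkov (κs n)) (hκ : IsSubMarkov κ) {f : I × E → ℝ} (hf : Measurable f)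
    {C : ℝ} (hC : ∀ z, |f z| ≤ C) (hcont : ∀ t, Continuous fun e => f (t, e)) :
    Tendsto (fun n => ∫ z, f z ∂(lam ⊗ₘ κs n)) atTop (𝓝 (∫ z, f z ∂(lam ⊗ₘ κ))) := by
  refine tendsto_order.2 ⟨fun a ha => ?_, fun a ha =>
    h.eventually_integral_lt hκs hκ hf hC (fun t => (hcont t).upperSemicontinuous) ha⟩
  have := h.eventually_integral_lt hκs hκ (f := fun z => -f z) hf.neg (C := C)
    (fun z => by rw [abs_neg]; exact hC z)
    (fun t => (hcont t).neg.upperSemicontinuous) (a := -a)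
    (by rw [integral_neg]; exact neg_lt_neg ha)
  filter_upwards [this] with n hn
  rw [integral_neg] at hn
  linarith

end Continuity

section Minimization

variable {X I E : Type*} [MeasurableSpace X] [MeasurableSpace I] [MeasurableSpace E]

/-- The cost `∫ G dμ + (Λ - ∫ f d(lam ⊗ κ))` of a pair `(μ, κ)`, with values in `[0, ∞]`. It is used
for `0 ≤ G` and `∫ f d(lam ⊗ κ) ≤ Λ`, where neither `ENNReal.ofReal` truncates. -/
noncomputable def cost (lam : Measure I) (Λ : ℝ) (f : I × E → ℝ) (G : X → ℝ)
    (p : Measure X × Kernel I E) : ℝ≥0∞ :=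
  ∫⁻ x, ENNReal.ofReal (G x) ∂p.1 + ENNReal.ofReal (Λ - ∫ z, f z ∂(lam ⊗ₘ p.2))

theorem compProd_midpoint {lam : Measure I} [IsFiniteMeasure lam] {κ₁ κ₂ κ : Kernel I E}
    [IsFiniteKernel κ₁] [IsFiniteKernel κ₂] [IsFiniteKernel κ]
    (h : ∀ t, κ t = (2⁻¹ : ℝ≥0∞) • (κ₁ t + κ₂ t)) :
    lam ⊗ₘ κ = (2⁻¹ : ℝ≥0∞) • (lam ⊗ₘ κ₁ + lam ⊗ₘ κ₂) := by
  refine Measure.ext fun s hs => ?_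
  simp only [Measure.smul_apply, Measure.add_apply, Measure.compProd_apply hs, h, smul_eq_mul]
  rw [lintegral_const_mul, lintegral_add_left]
  · exact Kernel.measurable_kernel_prodMk_left hs
  · exact (Kernel.measurable_kernel_prodMk_left hs).add (Kernel.measurable_kernel_prodMk_left hs)

theorem cost_midpoint_le {lam : Measure I} [IsFiniteMeasure lam] {Λ : ℝ} {f : I × E → ℝ}
    {G : X → ℝ} (hf : Measurable f) {C : ℝ} (hC : ∀ z, |f z| ≤ C)
    {p q r : Measure X × Kernel I E} (hp : IsSubMarkov p.2) (hq : IsSubMarkov q.2)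
    (hr : IsSubMarkov r.2) (h1 : r.1 = (2⁻¹ : ℝ≥0∞) • (p.1 + q.1))
    (h2 : ∀ t, r.2 t = (2⁻¹ : ℝ≥0∞) • (p.2 t + q.2 t)) {a : ℝ≥0∞}
    (hpa : cost lam Λ f G p ≤ a) (hqa : cost lam Λ f G q ≤ a) : cost lam Λ f G r ≤ a := by
  have := hp.isFiniteKernel
  have := hq.isFiniteKernel
  have := hr.isFiniteKernel
  have hint : ∀ (κ : Kernel I E) [IsFiniteKernel κ], Integrable f (lam ⊗ₘ κ) := fun κ _ =>
    Integrable.of_bound hf.aestronglyMeasurable C (Eventually.of_forall hC)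
  have h2inv : ENNReal.ofReal 2⁻¹ = 2⁻¹ := by
    rw [ENNReal.ofReal_inv_of_pos two_pos]
    simp
  have hle : ENNReal.ofReal (Λ - ∫ z, f z ∂(lam ⊗ₘ r.2)) ≤
      2⁻¹ * (ENNReal.ofReal (Λ - ∫ z, f z ∂(lam ⊗ₘ p.2)) +
        ENNReal.ofReal (Λ - ∫ z, f z ∂(lam ⊗ₘ q.2))) := by
    rw [compProd_midpoint h2, integral_smul_measure, integral_add_measure (hint _) (hint _)]
    have : Λ - (2⁻¹ : ℝ≥0∞).toReal • (∫ z, f z ∂(lam ⊗ₘ p.2) + ∫ z, f z ∂(lam ⊗ₘ q.2)) =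
        2⁻¹ * ((Λ - ∫ z, f z ∂(lam ⊗ₘ p.2)) + (Λ - ∫ z, f z ∂(lam ⊗ₘ q.2))) := by
      simp
      ring
    rw [this, ENNReal.ofReal_mul (by norm_num), h2inv]
    gcongr
    exact ENNReal.ofReal_add_le
  calc cost lam Λ f G r
      ≤ 2⁻¹ * (∫⁻ x, ENNReal.ofReal (G x) ∂p.1 + ∫⁻ x, ENNReal.ofReal (G x) ∂q.1) +
        2⁻¹ * (ENNReal.ofReal (Λ - ∫ z, f z ∂(lam ⊗ₘ p.2)) +
          ENNReal.ofReal (Λ - ∫ z, f z ∂(lam ⊗ₘ q.2))) := by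
        unfold cost
        rw [h1, lintegral_smul_measure, lintegral_add_measure, smul_eq_mul]
        gcongr
    _ = 2⁻¹ * (cost lam Λ f G p + cost lam Λ f G q) := by unfold cost; ring
    _ ≤ 2⁻¹ * (a + a) := by gcongr
    _ = a := by rw [← two_mul, ← mul_assoc, ENNReal.inv_mul_cancel (by simp) (by simp), one_mul]

variable [TopologicalSpace X] [BorelSpace X] [PolishSpace X] [TopologicalSpace E] [BorelSpace E]

/-- The cost is sequentially lower semicontinuous for weak convergence in the first and fibrewise
convergence in the second component. -/
theorem cost_le_of_tendsto {lam : Measure I} [IsFiniteMeasure lam] {Λ : ℝ} {f : I × E → ℝ}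
    (hf : Measurable f) {C : ℝ} (hC : ∀ z, |f z| ≤ C)
    (husc : ∀ t, UpperSemicontinuous fun e => f (t, e)) {G : X → ℝ}
    (hG : LowerSemicontinuous G) (hG0 : ∀ x, 0 ≤ G x)
    {μs : ℕ → ProbabilityMeasure X} {μ : ProbabilityMeasure X} {κs : ℕ → Kernel I E}
    {κ : Kernel I E} (hμ : Tendsto μs atTop (𝓝 μ)) (hκs : ∀ n, IsSubMarkov (κs n))
    (hκ : IsSubMarkov κ) (h : FiberwiseTendsto lam κs κ) {a : ℕ → ℝ≥0∞} {c : ℝ≥0∞}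
    (ha : Tendsto a atTop (𝓝 c)) (hle : ∀ n, cost lam Λ f G ((μs n : Measure X), κs n) ≤ a n) :
    cost lam Λ f G ((μ : Measure X), κ) ≤ c := by
  have hlsc := lintegral_le_liminf_lintegral_of_lowerSemicontinuous hG hG0 fun U hU =>
    ProbabilityMeasure.le_liminf_measure_open_of_tendsto hμ hU
  unfold cost at hle ⊢
  -- Both summands are suprema over strictly smaller values and `0`; the value `0` is added because
  -- no value lies strictly below a vanishing summand.
  have hsup : ∀ A : ℝ≥0∞, A ≤ ⨆ x, ⨆ _ : x < A ∨ x = 0, x := fun A =>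
    le_of_forall_lt_imp_le_of_dense fun x hx => le_iSup₂_of_le x (Or.inl hx) le_rfl
  refine (add_le_add (hsup _) (hsup _)).trans ?_
  refine ENNReal.biSup_add_biSup_le' (f := id) (g := id) (by exact ⟨0, Or.inr rfl⟩)
    (by exact ⟨0, Or.inr rfl⟩) fun x hx y hy => ge_of_tendsto ha ?_
  have h1 : ∀ᶠ n in atTop, x ≤ ∫⁻ z, ENNReal.ofReal (G z) ∂(μs n : Measure X) := by
    rcases hx with hx | rfl
    · exact (eventually_lt_of_lt_liminf (hx.trans_le hlsc)).mono fun n hn => hn.le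
    · exact Eventually.of_forall fun n => zero_le
  have h2 : ∀ᶠ n in atTop, y ≤ ENNReal.ofReal (Λ - ∫ z, f z ∂(lam ⊗ₘ κs n)) := by
    rcases hy with hy | rfl
    · have hy' : ∫ z, f z ∂(lam ⊗ₘ κ) < Λ - y.toReal := by
        have := (ENNReal.lt_ofReal_iff_toReal_lt hy.ne_top).1 hy
        linarith
      filter_upwards [h.eventually_integral_lt hκs hκ hf hC husc hy'] with n hn
      exact ((ENNReal.lt_ofReal_iff_toReal_lt hy.ne_top).2 (by linarith)).le
    · exact Eventually.of_forall fun n => zero_le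
  filter_upwards [h1, h2] with n h1 h2
  exact (add_le_add h1 h2).trans (hle n)

/-- The cost attains its minimum on a nonempty, midpoint-closed, uniformly tight set of pairs that
is stable under limits. -/
theorem exists_minimizer_cost [TopologicalSpace I] [BorelSpace I] [PolishSpace I] [PolishSpace E]
    {lam : Measure I} [IsFiniteMeasure lam] {Λ : ℝ} {f : I × E → ℝ}
    (hf : Measurable f) {C : ℝ} (hC : ∀ z, |f z| ≤ C)
    (husc : ∀ t, UpperSemicontinuous fun e => f (t, e)) {G : X → ℝ}
    (hG : LowerSemicontinuous G) (hG0 : ∀ x, 0 ≤ G x)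
    {P : Set (Measure X × Kernel I E)} (hne : P.Nonempty) (hmid : IsMidpointClosed P)
    (hprob : ∀ p ∈ P, IsProbabilityMeasure p.1) (hsub : ∀ p ∈ P, IsSubMarkov p.2)
    {K : ℕ → Set X} (hK : ∀ k, IsCompact (K k)) {K' : ℕ → Set (I × E)}
    (hK' : ∀ k, IsCompact (K' k)) {u : ℕ → ℝ≥0} (hu : Tendsto u atTop (𝓝 0))
    (hKu : ∀ p ∈ P, ∀ k, p.1 (K k)ᶜ ≤ u k)
    (hKu' : ∀ p ∈ P, ∀ k, (lam ⊗ₘ p.2) (K' k)ᶜ ≤ u k)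
    (hclosed : ∀ (μs : ℕ → ProbabilityMeasure X) (κs : ℕ → Kernel I E) (μ : ProbabilityMeasure X)
      (κ : Kernel I E), (∀ n, ((μs n : Measure X), κs n) ∈ P) → Tendsto μs atTop (𝓝 μ) →
      IsSubMarkov κ → FiberwiseTendsto lam κs κ → ((μ : Measure X), κ) ∈ P) :
    ∃ p ∈ P, ∀ q ∈ P, cost lam Λ f G p ≤ cost lam Λ f G q := by
  obtain ⟨a, ha, hlim, haP⟩ := exists_seq_tendsto_sInf (hne.image (cost lam Λ f G))
    (OrderBot.bddBelow _)
  -- The sublevel sets of the cost are midpoint-closed because the cost is convex.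
  obtain ⟨μs, κs, s, μ, κ, hs, hmem, hμ, hκ, hconv⟩ := exists_seq_tendsto_fiberwiseTendsto
    (lam := lam) (P := fun n => {p ∈ P | cost lam Λ f G p ≤ a n})
    (fun n m hnm p hp => ⟨hp.1, hp.2.trans (ha hnm)⟩)
    (fun n => by
      obtain ⟨p, hp, hpa⟩ := haP n
      exact ⟨p, hp, hpa.le⟩)
    (fun n p hp q hq => by
      obtain ⟨r, hr, h1, h2⟩ := hmid p hp.1 q hq.1
      exact ⟨r, ⟨hr, cost_midpoint_le hf hC (hsub p hp.1) (hsub q hq.1) (hsub r hr) h1 h2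
        hp.2 hq.2⟩, h1, h2⟩)
    (fun n p hp => hprob p hp.1) (fun n p hp => hsub p hp.1) hK hK' hu
    (fun n p hp => hKu p hp.1) (fun n p hp => hKu' p hp.1)
  refine ⟨_, hclosed μs κs μ κ (fun n => (hmem n).1) hμ hκ hconv, fun q hq => ?_⟩
  exact (cost_le_of_tendsto hf hC husc hG hG0 hμ (fun n => hsub _ (hmem n).1) hκ hconv
    (hlim.comp hs.tendsto_atTop) fun n => (hmem n).2).trans (sInf_le ⟨q, hq, rfl⟩)

end Minimization

/-! ### Flows of measures and sub-Markov kernels -/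

instance (T : ℝ) : IsFiniteMeasure (timeMeasure T) := by
  refine ⟨?_⟩
  rw [timeMeasure, comap_subtype_coe_apply measurableSet_Icc, image_univ,
    Subtype.range_coe]
  exact measure_Icc_lt_top

theorem measureReal_timeMeasure_univ {T : ℝ} (hT : 0 ≤ T) : (timeMeasure T).real univ = T := by
  rw [measureReal_def, timeMeasure, comap_subtype_coe_apply measurableSet_Icc, image_univ,
    Subtype.range_coe]
  simp [hT]

theorem integral_timeMeasure {T : ℝ} (hT : 0 ≤ T) (v : ℝ → ℝ) :
    ∫ t : Icc (0 : ℝ) T, v t ∂(timeMeasure T) = ∫ t in (0 : ℝ)..T, v t := by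
  rw [timeMeasure, integral_subtype_comap measurableSet_Icc, integral_Icc_eq_integral_Ioc,
    intervalIntegral.integral_of_le hT]

section Flow

variable {T : ℝ} {E : Type*} [MeasurableSpace E]

/-- The flow of measures `t ↦ κ t` of a sub-Markov kernel. -/
noncomputable def Flow.ofKernel (κ : Kernel (Icc (0 : ℝ) T) E) (hκ : IsSubMarkov κ) : Flow T E :=
  have := hκ.isFiniteKernel
  { toFun := fun t => (κ t).toSignedMeasure
    measurable_apply := fun B hB => by
      simp only [Measure.toSignedMeasure_apply_measurable hB, measureReal_def]
      exact (Kernel.measurable_coe κ hB).ennreal_toReal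
    finite_variation := by
      simp only [Measure.variation_toSignedMeasure]
      exact (lintegral_mono fun t => hκ t).trans_lt (by simp [measure_lt_top]) }

/-- The class of the flow of a sub-Markov kernel, as an element of the space `V`. -/
noncomputable def PosFlow.ofKernel (κ : Kernel (Icc (0 : ℝ) T) E) (hκ : IsSubMarkov κ) :
    PosFlow T E :=
  ⟨Quotient.mk (flowSetoid T E) (Flow.ofKernel κ hκ), Eventually.of_forall fun t B hB => by
    have := hκ.isFiniteKernel
    change (0 : ℝ) ≤ (κ t).toSignedMeasure B
    rw [Measure.toSignedMeasure_apply_measurable hB]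
    exact measureReal_nonneg⟩

theorem PosFlow.integral_ofKernel {κ : Kernel (Icc (0 : ℝ) T) E} (hκ : IsSubMarkov κ)
    {h : Icc (0 : ℝ) T × E → ℝ} (hm : Measurable h) {C : ℝ} (hC : ∀ z, |h z| ≤ C) :
    (PosFlow.ofKernel κ hκ).1.integral h = ∫ z, h z ∂(timeMeasure T ⊗ₘ κ) := by
  have := hκ.isFiniteKernel
  rw [Measure.integral_compProd
    (Integrable.of_bound hm.aestronglyMeasurable C (Eventually.of_forall hC))]
  change ∫ t, VectorMeasure.integral (κ t).toSignedMeasure _ _ ∂(timeMeasure T) = _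
  simp only [VectorMeasure.integral_toSignedMeasure]

theorem exists_toSignedMeasure_eq {ν : SignedMeasure E} (hν : 0 ≤ ν) :
    ∃ (μ : Measure E) (_ : IsFiniteMeasure μ), μ.toSignedMeasure = ν :=
  ⟨ν.toMeasureOfZeroLE univ MeasurableSet.univ
    ((VectorMeasure.le_restrict_univ_iff_le _ _).2 hν), inferInstance,
    ν.toMeasureOfZeroLE_toSignedMeasure _⟩

/-- A flow that is positive with mass at most `1` for almost every `t` is represented by a
sub-Markov kernel, namely its variation, set to `0` on a null set of times. -/
theorem Flow.exists_kernel (m : Flow T E)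
    (hm : ∀ᵐ t ∂(timeMeasure T), 0 ≤ m.toFun t ∧ m.toFun t univ ≤ 1) :
    ∃ κ : Kernel (Icc (0 : ℝ) T) E, IsSubMarkov κ ∧ ∀ (h : Icc (0 : ℝ) T × E → ℝ) (C : ℝ),
      Measurable h → (∀ z, |h z| ≤ C) → m.integral h = ∫ z, h z ∂(timeMeasure T ⊗ₘ κ) := by
  classical
  obtain ⟨N, hNsub, hNm, hN0⟩ := exists_measurable_superset_of_null (ae_iff.1 hm)
  have hpos : ∀ t ∉ N, ∃ (μ : Measure E) (_ : IsFiniteMeasure μ), μ.toSignedMeasure = m.toFun t :=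
    fun t ht => exists_toSignedMeasure_eq (by_contra fun h => ht (hNsub fun h' => h h'.1))
  have happ : ∀ t ∉ N, ∀ B, MeasurableSet B →
      (m.toFun t).variation B = ENNReal.ofReal (m.toFun t B) := by
    intro t ht B hB
    obtain ⟨μ, _, hμ⟩ := hpos t ht
    rw [← hμ, Measure.variation_toSignedMeasure, Measure.toSignedMeasure_apply_measurable hB,
      ofReal_measureReal]
  let κ : Kernel (Icc (0 : ℝ) T) E := ⟨fun t => if t ∈ N then 0 else (m.toFun t).variation, by
    refine Measure.measurable_of_measurable_coe _ fun B hB => ?_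
    have : (fun t => (if t ∈ N then 0 else (m.toFun t).variation : Measure E) B) =
        fun t => if t ∈ N then 0 else ENNReal.ofReal (m.toFun t B) := by
      ext t
      by_cases ht : t ∈ N
      · simp [ht]
      · simp [ht, happ t ht B hB]
    rw [this]
    exact Measurable.ite hNm measurable_const (m.measurable_apply B hB).ennreal_ofReal⟩
  have hκ : ∀ t, κ t = if t ∈ N then 0 else (m.toFun t).variation := fun t => rfl
  have hsub : IsSubMarkov κ := by
    intro t
    by_cases ht : t ∈ N
    · simp [hκ, ht]
    · have : m.toFun t univ ≤ 1 := by_contra fun h => ht (hNsub fun h' => h h'.2)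
      simpa [hκ, ht, happ t ht univ MeasurableSet.univ] using this
  refine ⟨κ, hsub, fun h C hh hC => ?_⟩
  have := hsub.isFiniteKernel
  rw [Measure.integral_compProd
    (Integrable.of_bound hh.aestronglyMeasurable C (Eventually.of_forall hC))]
  refine integral_congr_ae ?_
  have hN : ∀ᵐ t ∂(timeMeasure T), t ∉ N := measure_eq_zero_iff_ae_notMem.1 hN0
  filter_upwards [hN] with t ht
  obtain ⟨μ, _, hμ⟩ := hpos t ht
  rw [hκ, if_neg ht, ← hμ, VectorMeasure.integral_toSignedMeasure,
    Measure.variation_toSignedMeasure]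

theorem Flow.integrable_univ (m : Flow T E) :
    Integrable (fun t => m.toFun t univ) (timeMeasure T) := by
  refine ⟨(m.measurable_apply univ MeasurableSet.univ).aestronglyMeasurable, ?_⟩
  exact (lintegral_mono fun t => (m.toFun t).enorm_measure_le_variation univ).trans_lt
    m.finite_variation

theorem Flow.integral_of_time (m : Flow T E) (hm : ∀ᵐ t ∂(timeMeasure T), 0 ≤ m.toFun t)
    (v : Icc (0 : ℝ) T → ℝ) :
    m.integral (fun z => v z.1) = ∫ t, v t * m.toFun t univ ∂(timeMeasure T) := by
  refine integral_congr_ae ?_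
  filter_upwards [hm] with t ht
  obtain ⟨μ, _, hμ⟩ := exists_toSignedMeasure_eq ht
  rw [← hμ, VectorMeasure.integral_toSignedMeasure, integral_const,
    Measure.toSignedMeasure_apply_measurable MeasurableSet.univ, smul_eq_mul, mul_comm]

end Flow

/-- A density `a` such that `∫ ψ a ≤ ∫ ψ` for all continuous `ψ ≥ 0` is at most `1`: otherwise
`{a > 1}` contains a closed set `F` of positive measure, whose indicator is a limit of such `ψ`. -/
theorem ae_le_one_of_forall_integral_mul_le {I : Type*} [TopologicalSpace I]
    [TopologicalSpace.PseudoMetrizableSpace I] [MeasurableSpace I] [BorelSpace I] {lam : Measure I}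
    [IsFiniteMeasure lam] {a : I → ℝ} (ha : Measurable a) (hint : Integrable a lam)
    (h : ∀ ψ : I → ℝ, Continuous ψ → (∀ t, 0 ≤ ψ t) → ∫ t, ψ t * a t ∂lam ≤ ∫ t, ψ t ∂lam) :
    ∀ᵐ t ∂lam, a t ≤ 1 := by
  rw [ae_iff]
  by_contra hne
  have hS : MeasurableSet {t | ¬ a t ≤ 1} := (measurableSet_le ha measurable_const).compl
  obtain ⟨F, hFS, hF, hFpos⟩ := hS.exists_lt_isClosed_of_ne_top (measure_ne_top _ _)
    (pos_iff_ne_zero.2 hne)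
  have hint1 : Integrable (fun t => a t - 1) lam := hint.sub (integrable_const 1)
  have hlim : Tendsto (fun n => ∫ t, (hF.apprSeq n t : ℝ) * (a t - 1) ∂lam) atTop
      (𝓝 (∫ t, F.indicator (fun t => a t - 1) t ∂lam)) := by
    refine tendsto_integral_of_dominated_convergence (fun t => ‖a t - 1‖)
      (fun n => ((hF.apprSeq n).continuous.measurable.coe_nnreal_real.mul
        (ha.sub measurable_const)).aestronglyMeasurable) hint1.norm
      (fun n => Eventually.of_forall fun t => ?_) (Eventually.of_forall fun t => ?_)
    · rw [norm_mul]
      refine mul_le_of_le_one_left (norm_nonneg _) ?_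
      simpa using HasOuterApproxClosed.apprSeq_apply_le_one hF n t
    · have := ((NNReal.tendsto_coe.2 (tendsto_pi_nhds.1
        (HasOuterApproxClosed.tendsto_apprSeq hF) t)).mul_const (a t - 1))
      by_cases ht : t ∈ F <;> simpa [ht] using this
  have hle : ∫ t, F.indicator (fun t => a t - 1) t ∂lam ≤ 0 := by
    refine le_of_tendsto' hlim fun n => ?_
    have hψ : Continuous fun t => (hF.apprSeq n t : ℝ) :=
      NNReal.continuous_coe.comp (hF.apprSeq n).continuous
    have hbd : ∀ᵐ t ∂lam, ‖(hF.apprSeq n t : ℝ)‖ ≤ 1 := Eventually.of_forall fun t => by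
      simpa using HasOuterApproxClosed.apprSeq_apply_le_one hF n t
    have h1 := h _ hψ fun t => NNReal.coe_nonneg _
    simp only [mul_sub, mul_one]
    rw [integral_sub (hint.bdd_mul hψ.measurable.aestronglyMeasurable hbd)
      (Integrable.of_bound hψ.measurable.aestronglyMeasurable 1 hbd)]
    linarith
  rw [integral_indicator hF.measurableSet] at hle
  have hpos : 0 < ∫ t in F, (a t - 1) ∂lam := by
    rw [setIntegral_pos_iff_support_of_nonneg_ae]
    · refine hFpos.trans_le (measure_mono fun t ht => ⟨?_, ht⟩)
      have : 1 < a t := not_le.1 (hFS ht)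
      exact (sub_pos.2 this).ne'
    · refine (ae_restrict_iff' hF.measurableSet).2 (Eventually.of_forall fun t ht => ?_)
      have : 1 < a t := not_le.1 (hFS ht)
      exact (sub_pos.2 this).le
    · exact hint1.integrableOn
  linarith

/-! ### Test functions -/

theorem uniqueDiffOn_closure_of_isOpen {O : Set ℝ} (hO : IsOpen O) :
    UniqueDiffOn ℝ (closure O) := by
  intro x hx
  rw [uniqueDiffWithinAt_iff_accPt, accPt_iff_clusterPt, inf_principal, inter_comm,
    ← mem_closure_iff_clusterPt]
  have h1 : O ⊆ closure (O ∩ {x}ᶜ) := (dense_compl_singleton x).open_subset_closure_inter hO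
  exact closure_mono (inter_subset_inter_left _ subset_closure)
    (closure_minimal h1 isClosed_closure hx)

section TestFunctions

variable {T : ℝ} {K : Set ℝ}

theorem IsCb.congr {u v : ℝ → ℝ → ℝ} (hu : IsCb T K u)
    (h : ∀ t ∈ Icc (0 : ℝ) T, ∀ x ∈ K, v t x = u t x) : IsCb T K v := by
  obtain ⟨hc, C, hC⟩ := hu
  exact ⟨hc.congr fun p hp => h p.1 hp.1 p.2 hp.2, C, fun t ht x hx => by
    rw [h t ht x hx]; exact hC t ht x hx⟩

theorem IsCb.continuous {u : ℝ → ℝ → ℝ} (hu : IsCb T K u) :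
    Continuous fun z : Icc (0 : ℝ) T × K => u z.1 z.2 :=
  hu.1.comp_continuous (f := fun z : Icc (0 : ℝ) T × K => ((z.1 : ℝ), (z.2 : ℝ)))
    (by fun_prop) fun z => ⟨z.1.2, z.2.2⟩

theorem isCb_mul {p q : ℝ → ℝ} (hp : Continuous p) (hq : Continuous q) {B : ℝ}
    (hB : ∀ x, |q x| ≤ B) : IsCb T K fun t x => p t * q x := by
  refine ⟨by fun_prop, ?_⟩
  obtain ⟨C, hC⟩ := isCompact_Icc.exists_bound_of_continuousOn (s := Icc (0 : ℝ) T) hp.continuousOn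
  refine ⟨C * B, fun t ht x _ => ?_⟩
  rw [abs_mul]
  exact mul_le_mul (hC t ht) (hB x) (abs_nonneg _) ((norm_nonneg _).trans (hC t ht))

theorem IsCb12.integrable {u : ℝ → ℝ → ℝ} (hu : IsCb12 T (K) u)
    (μ : Measure (Icc (0 : ℝ) T × K)) [IsFiniteMeasure μ] :
    Integrable (fun z => u z.1 z.2) μ := by
  obtain ⟨C, hC⟩ := hu.cb.2
  exact Integrable.of_bound hu.cb.continuous.measurable.aestronglyMeasurable C
    (Eventually.of_forall fun z => hC z.1 z.1.2 z.2 z.2.2)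

variable {p p' q q' q'' : ℝ → ℝ}

theorem timeDeriv_mul (hT : 0 < T) (hp : ∀ t, HasDerivAt p (p' t) t) {t : ℝ}
    (ht : t ∈ Icc (0 : ℝ) T) (x : ℝ) : timeDeriv T (fun t x => p t * q x) t x = p' t * q x :=
  (((hp t).mul_const (q x)).hasDerivWithinAt).derivWithin (uniqueDiffOn_Icc hT t ht)

theorem spaceDeriv_mul (hK : UniqueDiffOn ℝ K) (hq : ∀ x, HasDerivAt q (q' x) x) (t : ℝ) {x : ℝ}
    (hx : x ∈ K) : spaceDeriv K (fun t x => p t * q x) t x = p t * q' x :=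
  (((hq x).const_mul (p t)).hasDerivWithinAt).derivWithin (hK x hx)

theorem spaceDeriv_spaceDeriv_mul (hK : UniqueDiffOn ℝ K) (hq : ∀ x, HasDerivAt q (q' x) x)
    (hq' : ∀ x, HasDerivAt q' (q'' x) x) (t : ℝ) {x : ℝ} (hx : x ∈ K) :
    spaceDeriv K (spaceDeriv K fun t x => p t * q x) t x = p t * q'' x := by
  have h : ∀ y ∈ K, spaceDeriv K (fun t x => p t * q x) t y = p t * q' y := fun y hy =>
    spaceDeriv_mul hK hq t hy
  rw [spaceDeriv, derivWithin_congr h (h x hx)]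
  exact spaceDeriv_mul hK hq' t hx

theorem isCb12_mul (hT : 0 < T) (hK : UniqueDiffOn ℝ K) (hp : ∀ t, HasDerivAt p (p' t) t)
    (hp' : Continuous p') (hq : ∀ x, HasDerivAt q (q' x) x) (hq' : ∀ x, HasDerivAt q' (q'' x) x)
    (hq'' : Continuous q'') {B : ℝ} (hB : ∀ x, |q x| ≤ B) (hB' : ∀ x, |q' x| ≤ B)
    (hB'' : ∀ x, |q'' x| ≤ B) : IsCb12 T K fun t x => p t * q x := by
  have hpc : Continuous p := continuous_iff_continuousAt.2 fun t => (hp t).continuousAt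
  have hqc : Continuous q := continuous_iff_continuousAt.2 fun x => (hq x).continuousAt
  have hqc' : Continuous q' := continuous_iff_continuousAt.2 fun x => (hq' x).continuousAt
  refine ⟨fun t _ x _ => ((hp t).mul_const (q x)).differentiableAt.differentiableWithinAt,
    fun t _ x _ => ((hq x).const_mul (p t)).differentiableAt.differentiableWithinAt,
    fun t _ x hx => ?_, isCb_mul hpc hqc hB,
    (isCb_mul hp' hqc hB).congr fun t ht x _ => timeDeriv_mul hT hp ht x,
    (isCb_mul hpc hqc' hB').congr fun t _ x hx => spaceDeriv_mul hK hq t hx,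
    (isCb_mul hpc hq'' hB'').congr fun t _ x hx => spaceDeriv_spaceDeriv_mul hK hq hq' t hx⟩
  exact (((hq' x).const_mul (p t)).differentiableAt.differentiableWithinAt).congr
    (fun y hy => spaceDeriv_mul hK hq t hy) (spaceDeriv_mul hK hq t hx)

end TestFunctions

section Cutoff

/-- The function `y² / (1 + y²)`, which vanishes at `0`, is bounded with its first two derivatives,
and is at least `1/2` outside `(-1, 1)`. The tails of a law are controlled by its rescalings
`x ↦ cutoff (ε * x)`, whose derivatives are of order `ε`. -/
noncomputable def cutoff (y : ℝ) : ℝ := y ^ 2 / (1 + y ^ 2)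

/-- The derivative of `cutoff`. -/
noncomputable def cutoffDeriv (y : ℝ) : ℝ := 2 * y / (1 + y ^ 2) ^ 2

/-- The second derivative of `cutoff`. -/
noncomputable def cutoffDeriv₂ (y : ℝ) : ℝ := (2 - 6 * y ^ 2) / (1 + y ^ 2) ^ 3

theorem one_add_sq_pos (y : ℝ) : 0 < 1 + y ^ 2 := by positivity

theorem hasDerivAt_cutoff (y : ℝ) : HasDerivAt cutoff (cutoffDeriv y) y := by
  have h1 : HasDerivAt (fun y : ℝ => y ^ 2) (2 * y) y := by simpa using hasDerivAt_pow 2 y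
  have h := h1.div (h1.const_add 1) (one_add_sq_pos y).ne'
  refine h.congr_deriv ?_
  unfold cutoffDeriv
  have := (one_add_sq_pos y).ne'
  field_simp
  ring

theorem hasDerivAt_cutoffDeriv (y : ℝ) : HasDerivAt cutoffDeriv (cutoffDeriv₂ y) y := by
  have h1 : HasDerivAt (fun y : ℝ => y ^ 2) (2 * y) y := by simpa using hasDerivAt_pow 2 y
  have h := ((hasDerivAt_id y).const_mul 2).div ((h1.const_add 1).pow 2)
    (pow_ne_zero 2 (one_add_sq_pos y).ne')
  refine h.congr_deriv ?_
  unfold cutoffDeriv₂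
  have := (one_add_sq_pos y).ne'
  simp only [Nat.cast_ofNat, id, Pi.pow_apply]
  field_simp
  ring

theorem continuous_cutoffDeriv₂ : Continuous cutoffDeriv₂ := by
  unfold cutoffDeriv₂
  exact Continuous.div (by fun_prop) (by fun_prop) fun y => (pow_pos (one_add_sq_pos y) 3).ne'

theorem continuous_cutoff : Continuous cutoff :=
  continuous_iff_continuousAt.2 fun y => (hasDerivAt_cutoff y).continuousAt

theorem cutoff_nonneg (y : ℝ) : 0 ≤ cutoff y := by unfold cutoff; positivity

theorem cutoff_le_one (y : ℝ) : cutoff y ≤ 1 := by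
  rw [cutoff, div_le_one (one_add_sq_pos y)]; linarith

theorem half_le_cutoff {y : ℝ} (hy : 1 ≤ |y|) : 2⁻¹ ≤ cutoff y := by
  have : 1 ≤ y ^ 2 := by rw [← sq_abs]; nlinarith
  rw [cutoff, le_div_iff₀ (one_add_sq_pos y)]; linarith

theorem abs_cutoffDeriv_le (y : ℝ) : |cutoffDeriv y| ≤ 1 := by
  rw [cutoffDeriv, abs_div, abs_of_pos (pow_pos (one_add_sq_pos y) 2),
    div_le_one (pow_pos (one_add_sq_pos y) 2), abs_le]
  constructor <;> nlinarith [sq_nonneg (y - 1), sq_nonneg (y + 1), sq_nonneg (y ^ 2)]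

theorem abs_cutoffDeriv₂_le (y : ℝ) : |cutoffDeriv₂ y| ≤ 6 := by
  rw [cutoffDeriv₂, abs_div, abs_of_pos (pow_pos (one_add_sq_pos y) 3),
    div_le_iff₀ (pow_pos (one_add_sq_pos y) 3), abs_le]
  constructor <;> nlinarith [sq_nonneg y, pow_nonneg (sq_nonneg y) 2, pow_nonneg (sq_nonneg y) 3]

variable (ε : ℝ)

theorem hasDerivAt_cutoff_mul (x : ℝ) :
    HasDerivAt (fun x => cutoff (ε * x)) (ε * cutoffDeriv (ε * x)) x := by
  have h : HasDerivAt (fun x => ε * x) (ε * 1) x := (hasDerivAt_id x).const_mul ε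
  exact ((hasDerivAt_cutoff (ε * x)).comp x h).congr_deriv (by ring)

theorem hasDerivAt_cutoffDeriv_mul (x : ℝ) :
    HasDerivAt (fun x => ε * cutoffDeriv (ε * x)) (ε ^ 2 * cutoffDeriv₂ (ε * x)) x := by
  have h : HasDerivAt (fun x => ε * x) (ε * 1) x := (hasDerivAt_id x).const_mul ε
  exact (((hasDerivAt_cutoffDeriv (ε * x)).comp x h).const_mul ε).congr_deriv (by ring)

end Cutoff

namespace ProblemData

variable {T : ℝ} {O A : Set ℝ} {D : ProblemData T O A}

theorem measurable_generator (hD : SingleAgentAssumption D) {u : ℝ → ℝ → ℝ}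
    (hu : IsCb12 T (closure O) u) : Measurable (D.generator u) := by
  have hz : Measurable fun z : Icc (0 : ℝ) T × closure O × A => (z.1, z.2.1) := by fun_prop
  have hb : Measurable fun z : Icc (0 : ℝ) T × closure O × A => D.b (z.1, (z.2.1 : ℝ), z.2.2) :=
    hD.b_classS.1
  have hσ : Measurable fun z : Icc (0 : ℝ) T × closure O × A => D.σ (z.1, (z.2.1 : ℝ), z.2.2) :=
    hD.σ_classS.1
  exact (hu.cb_time.continuous.measurable.comp hz).add
    ((hb.mul (hu.cb_space.continuous.measurable.comp hz)).add
      (((hσ.pow_const 2).div_const 2).mul (hu.cb_space_two.continuous.measurable.comp hz)))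

theorem continuous_generator (hD : SingleAgentAssumption D) {u : ℝ → ℝ → ℝ}
    (hu : IsCb12 T (closure O) u) (t : Icc (0 : ℝ) T) :
    Continuous fun e : closure O × A => D.generator u (t, e) := by
  have hz : Continuous fun e : closure O × A => (t, e.1) := by fun_prop
  have hb : Continuous fun e : closure O × A => D.b (t, (e.1 : ℝ), e.2) := hD.b_classS.2.2 t
  have hσ : Continuous fun e : closure O × A => D.σ (t, (e.1 : ℝ), e.2) := hD.σ_classS.2.2 t
  exact (hu.cb_time.continuous.comp hz).add
    ((hb.mul (hu.cb_space.continuous.comp hz)).add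
      (((hσ.pow 2).div_const 2).mul (hu.cb_space_two.continuous.comp hz)))

theorem exists_abs_generator_le (hD : SingleAgentAssumption D) {u : ℝ → ℝ → ℝ}
    (hu : IsCb12 T (closure O) u) : ∃ C, ∀ z, |D.generator u z| ≤ C := by
  obtain ⟨C₁, h₁⟩ := hu.cb_time.2
  obtain ⟨C₂, h₂⟩ := hu.cb_space.2
  obtain ⟨C₃, h₃⟩ := hu.cb_space_two.2
  obtain ⟨B, hB⟩ := hD.b_regular.2.1
  obtain ⟨S, hS⟩ := hD.σ_regular.2.1
  refine ⟨C₁ + (B * C₂ + S ^ 2 / 2 * C₃), fun z => ?_⟩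
  have k₁ := h₁ z.1 z.1.2 z.2.1 z.2.1.2
  have k₂ := h₂ z.1 z.1.2 z.2.1 z.2.1.2
  have k₃ := h₃ z.1 z.1.2 z.2.1 z.2.1.2
  have kB := hB (z.1, (z.2.1 : ℝ), z.2.2)
  have kS := hS (z.1, (z.2.1 : ℝ), z.2.2)
  refine (abs_add_le _ _).trans (add_le_add k₁ ((abs_add_le _ _).trans (add_le_add ?_ ?_)))
  · rw [abs_mul]
    exact mul_le_mul kB k₂ (abs_nonneg _) ((abs_nonneg _).trans kB)
  · rw [abs_mul, abs_div, abs_pow, abs_two]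
    gcongr

theorem generator_mul (hT : 0 < T) (hO : IsOpen O) {p p' q q' q'' : ℝ → ℝ}
    (hp : ∀ t, HasDerivAt p (p' t) t) (hq : ∀ x, HasDerivAt q (q' x) x)
    (hq' : ∀ x, HasDerivAt q' (q'' x) x) (z : Icc (0 : ℝ) T × closure O × A) :
    D.generator (fun t x => p t * q x) z = p' z.1 * q z.2.1 +
      (D.b (z.1, (z.2.1 : ℝ), z.2.2) * (p z.1 * q' z.2.1) +
        D.σ (z.1, (z.2.1 : ℝ), z.2.2) ^ 2 / 2 * (p z.1 * q'' z.2.1)) := by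
  have hK := uniqueDiffOn_closure_of_isOpen hO
  rw [generator, timeDeriv_mul hT hp z.1.2, spaceDeriv_mul hK hq _ z.2.1.2,
    spaceDeriv_spaceDeriv_mul hK hq hq' _ z.2.1.2]

end ProblemData

/-! ### The constraint set in terms of kernels -/

namespace ProblemData

variable {T : ℝ} {O A : Set ℝ} {D : ProblemData T O A}

/-- The constraint set `ℛ`, with flows represented by sub-Markov kernels and the measure on
`[0, T] × cl(O)` by an unbundled probability measure. -/
def kernelAdmissible (D : ProblemData T O A) :
    Set (Measure (Icc (0 : ℝ) T × closure O) × Kernel (Icc (0 : ℝ) T) (closure O × A)) :=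
  {p | IsProbabilityMeasure p.1 ∧ IsSubMarkov p.2 ∧ ∀ u : ℝ → ℝ → ℝ, IsCb12 T (closure O) u →
    ∫ z, u z.1 z.2 ∂p.1 =
      ∫ x, u 0 x ∂(D.m₀ : Measure O) + ∫ z, D.generator u z ∂(timeMeasure T ⊗ₘ p.2)}

/-- The measures of an admissible flow have mass at most `1` for almost every `t`: the constraint
for `u(t, x) = ∫₀ᵗ v` with `v ≥ 0` gives `∫ v(t) m_t(cl(O) × A) dt = ∫ u dμ ≤ ∫₀ᵀ v(t) dt`. -/
theorem ae_apply_univ_le_one (hT : 0 < T) (hO : IsOpen O)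
    {μ : ProbabilityMeasure (Icc (0 : ℝ) T × closure O)} {m : Flow T (closure O × A)}
    (hm : ∀ᵐ t ∂(timeMeasure T), 0 ≤ m.toFun t)
    (h : ∀ u : ℝ → ℝ → ℝ, IsCb12 T (closure O) u →
      ∫ z, u z.1 z.2 ∂(μ : Measure (Icc (0 : ℝ) T × closure O)) =
        ∫ x, u 0 x ∂(D.m₀ : Measure O) + m.integral (D.generator u)) :
    ∀ᵐ t ∂(timeMeasure T), m.toFun t univ ≤ 1 := by
  refine ae_le_one_of_forall_integral_mul_le (m.measurable_apply univ MeasurableSet.univ)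
    m.integrable_univ fun ψ hψ hψ0 => ?_
  set v : ℝ → ℝ := IccExtend hT.le ψ with hv
  have hvc : Continuous v := hψ.Icc_extend'
  have hv0 : ∀ t, 0 ≤ v t := fun t => hψ0 _
  have hvψ : ∀ t : Icc (0 : ℝ) T, v t = ψ t := fun t => IccExtend_val hT.le ψ t
  set p : ℝ → ℝ := fun t => ∫ r in (0 : ℝ)..t, v r with hpdef
  have hp : ∀ t, HasDerivAt p (v t) t := fun t => (hvc.integral_hasStrictDerivAt 0 t).hasDerivAt
  have hpc : Continuous p := continuous_iff_continuousAt.2 fun t => (hp t).continuousAt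
  have h1 : ∀ x : ℝ, HasDerivAt (fun _ : ℝ => (1 : ℝ)) ((fun _ : ℝ => (0 : ℝ)) x) x := fun x =>
    hasDerivAt_const x 1
  have h0 : ∀ x : ℝ, HasDerivAt (fun _ : ℝ => (0 : ℝ)) ((fun _ : ℝ => (0 : ℝ)) x) x := fun x =>
    hasDerivAt_const x 0
  have hgen : D.generator (fun t _ => p t * 1) = fun z => ψ z.1 := by
    ext z
    rw [generator_mul hT hO hp h1 h0]
    simp [hvψ]
  have key := h (fun t _ => p t * 1) (isCb12_mul hT (uniqueDiffOn_closure_of_isOpen hO) hp hvc h1 h0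
    continuous_const (B := 1) (by simp) (by simp) (by simp))
  rw [hgen, m.integral_of_time hm] at key
  have hp0 : p 0 = 0 := by simp [hpdef]
  simp only [hp0, mul_one, integral_zero, zero_add] at key
  rw [← key]
  have hpmono : Monotone p := monotone_of_hasDerivAt_nonneg hp hv0
  have hle : ∀ z : Icc (0 : ℝ) T × closure O, p z.1 ≤ p T := fun z => hpmono z.1.2.2
  have hge : ∀ z : Icc (0 : ℝ) T × closure O, 0 ≤ p z.1 := fun z =>
    hp0.ge.trans (hpmono z.1.2.1)
  calc ∫ z, p z.1 ∂(μ : Measure (Icc (0 : ℝ) T × closure O))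
      ≤ ∫ _, p T ∂(μ : Measure (Icc (0 : ℝ) T × closure O)) := by
        refine integral_mono (Integrable.of_bound (C := p T) ?_ (Eventually.of_forall fun z => ?_))
          (integrable_const _) hle
        · exact (hpc.measurable.comp (measurable_subtype_coe.comp
            measurable_fst)).aestronglyMeasurable
        · rw [Real.norm_of_nonneg (hge z)]
          exact hle z
    _ = ∫ t, ψ t ∂(timeMeasure T) := by
        rw [integral_const, probReal_univ, one_smul]
        simpa only [hvψ] using (integral_timeMeasure hT.le v).symm

theorem exists_kernel_of_mem_admissible (hT : 0 < T) (hO : IsOpen O)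
    (hD : SingleAgentAssumption D)
    {q : ProbabilityMeasure (Icc (0 : ℝ) T × closure O) × PosFlow T (closure O × A)}
    (hq : q ∈ D.admissible) :
    ∃ κ : Kernel (Icc (0 : ℝ) T) (closure O × A), ((q.1 : Measure _), κ) ∈ D.kernelAdmissible ∧
      ∀ (h : Icc (0 : ℝ) T × closure O × A → ℝ) (C : ℝ), Measurable h → (∀ z, |h z| ≤ C) →
        q.2.1.integral h = ∫ z, h z ∂(timeMeasure T ⊗ₘ κ) := by
  obtain ⟨μ, ⟨m, hm⟩⟩ := q
  induction m using Quotient.inductionOn with | _ m => ?_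
  have hm' : ∀ᵐ t ∂(timeMeasure T), 0 ≤ m.toFun t := hm
  have hq' : ∀ u : ℝ → ℝ → ℝ, IsCb12 T (closure O) u →
      ∫ z, u z.1 z.2 ∂(μ : Measure (Icc (0 : ℝ) T × closure O)) =
        ∫ x, u 0 x ∂(D.m₀ : Measure O) + m.integral (D.generator u) := hq
  obtain ⟨κ, hκ, hint⟩ := m.exists_kernel
    (hm'.and (ae_apply_univ_le_one hT hO hm' hq'))
  refine ⟨κ, ⟨inferInstance, hκ, fun u hu => ?_⟩, hint⟩
  obtain ⟨C, hC⟩ := exists_abs_generator_le hD hu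
  rw [hq' u hu, hint _ C (measurable_generator hD hu) hC]

theorem ofKernel_mem_admissible (hD : SingleAgentAssumption D)
    {μ : ProbabilityMeasure (Icc (0 : ℝ) T × closure O)}
    {κ : Kernel (Icc (0 : ℝ) T) (closure O × A)}
    (h : ((μ : Measure _), κ) ∈ D.kernelAdmissible) :
    (μ, PosFlow.ofKernel κ h.2.1) ∈ D.admissible := by
  intro u hu
  obtain ⟨C, hC⟩ := exists_abs_generator_le hD hu
  rw [PosFlow.integral_ofKernel h.2.1 (measurable_generator hD hu) hC]
  exact h.2.2 u hu

/-- Stopping immediately is admissible: `μ` is the law of `(0, x)` under `m₀`, and the flow is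
zero. -/
theorem kernelAdmissible_nonempty (hT : 0 < T) : D.kernelAdmissible.Nonempty := by
  let ι : O → Icc (0 : ℝ) T × closure O := fun x =>
    (⟨0, left_mem_Icc.2 hT.le⟩, ⟨x, subset_closure x.2⟩)
  have hι : Measurable ι := by fun_prop
  refine ⟨((D.m₀ : Measure O).map ι, 0), Measure.isProbabilityMeasure_map hι.aemeasurable,
    fun t => by simp, fun u hu => ?_⟩
  rw [integral_map hι.aemeasurable hu.cb.continuous.measurable.aestronglyMeasurable]
  simp [ι]

theorem integrable_generator (hD : SingleAgentAssumption D) {u : ℝ → ℝ → ℝ}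
    (hu : IsCb12 T (closure O) u) (M : Measure (Icc (0 : ℝ) T × closure O × A))
    [IsFiniteMeasure M] : Integrable (D.generator u) M := by
  obtain ⟨C, hC⟩ := exists_abs_generator_le hD hu
  exact Integrable.of_bound (measurable_generator hD hu).aestronglyMeasurable C
    (Eventually.of_forall hC)

theorem isMidpointClosed_kernelAdmissible (hD : SingleAgentAssumption D) :
    IsMidpointClosed D.kernelAdmissible := by
  intro p hp q hq
  have := hp.1
  have := hq.1
  have := hp.2.1.isFiniteKernel
  have := hq.2.1.isFiniteKernel
  let κ : Kernel (Icc (0 : ℝ) T) (closure O × A) :=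
    ⟨fun t => (2⁻¹ : ℝ≥0∞) • (p.2 t + q.2 t), by
      refine Measure.measurable_of_measurable_coe _ fun s hs => ?_
      exact ((Kernel.measurable_coe p.2 hs).add (Kernel.measurable_coe q.2 hs)).const_mul 2⁻¹⟩
  have hκ : ∀ t, κ t = (2⁻¹ : ℝ≥0∞) • (p.2 t + q.2 t) := fun t => rfl
  have hhalf : (2⁻¹ : ℝ≥0∞) * (1 + 1) = 1 := by
    rw [one_add_one_eq_two, ENNReal.inv_mul_cancel (by simp) (by simp)]
  have hsub : IsSubMarkov κ := fun t => by
    rw [hκ, Measure.smul_apply, Measure.add_apply, smul_eq_mul, ← hhalf]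
    gcongr
    exacts [hp.2.1 t, hq.2.1 t]
  have := hsub.isFiniteKernel
  refine ⟨((2⁻¹ : ℝ≥0∞) • (p.1 + q.1), κ), ⟨⟨?_⟩, hsub, fun u hu => ?_⟩, rfl, hκ⟩
  · simp only [Measure.smul_apply, Measure.add_apply, measure_univ, smul_eq_mul, hhalf]
  · simp only [compProd_midpoint hκ, integral_smul_measure]
    rw [integral_add_measure (hu.integrable _) (hu.integrable _),
      integral_add_measure (integrable_generator hD hu _) (integrable_generator hD hu _),
      hp.2.2 u hu, hq.2.2 u hu]
    simp only [ENNReal.toReal_inv, ENNReal.toReal_ofNat, smul_eq_mul]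
    ring

theorem mem_kernelAdmissible_of_tendsto (hD : SingleAgentAssumption D)
    {μs : ℕ → ProbabilityMeasure (Icc (0 : ℝ) T × closure O)}
    {κs : ℕ → Kernel (Icc (0 : ℝ) T) (closure O × A)}
    {μ : ProbabilityMeasure (Icc (0 : ℝ) T × closure O)}
    {κ : Kernel (Icc (0 : ℝ) T) (closure O × A)}
    (hmem : ∀ n, ((μs n : Measure _), κs n) ∈ D.kernelAdmissible) (hμ : Tendsto μs atTop (𝓝 μ))
    (hκ : IsSubMarkov κ) (h : FiberwiseTendsto (timeMeasure T) κs κ) :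
    ((μ : Measure _), κ) ∈ D.kernelAdmissible := by
  refine ⟨inferInstance, hκ, fun u hu => ?_⟩
  obtain ⟨C, hC⟩ := hu.cb.2
  obtain ⟨C', hC'⟩ := exists_abs_generator_le hD hu
  let U : BoundedContinuousFunction (Icc (0 : ℝ) T × closure O) ℝ :=
    BoundedContinuousFunction.ofNormedAddCommGroup (fun z => u z.1 z.2) hu.cb.continuous C
      fun z => hC z.1 z.1.2 z.2 z.2.2
  have h1 := ProbabilityMeasure.tendsto_iff_forall_integral_tendsto.1 hμ U
  have h2 := h.tendsto_integral (fun n => (hmem n).2.1) hκ (measurable_generator hD hu) hC'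
    (continuous_generator hD hu)
  refine tendsto_nhds_unique h1 ?_
  refine (h2.const_add (∫ x, u 0 x ∂(D.m₀ : Measure O))).congr fun n => ?_
  exact ((hmem n).2.2 u hu).symm

end ProblemData

/-! ### Tightness and the objective -/

/-- Markov's inequality for the cutoff function. -/
theorem measure_lt_abs_mul_le {Z : Type*} [MeasurableSpace Z] {μ : Measure Z} [IsFiniteMeasure μ]
    {F : Z → ℝ} (hF : Measurable F) (ε : ℝ) {r : ℝ} (h : ∫ z, cutoff (ε * F z) ∂μ ≤ r) :
    μ {z | 1 < |ε * F z|} ≤ ENNReal.ofReal (2 * r) := by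
  have hm : Measurable fun z => cutoff (ε * F z) :=
    continuous_cutoff.measurable.comp (hF.const_mul ε)
  have hint : Integrable (fun z => cutoff (ε * F z)) μ := Integrable.of_bound
    hm.aestronglyMeasurable 1 (Eventually.of_forall fun z => by
      rw [Real.norm_of_nonneg (cutoff_nonneg _)]; exact cutoff_le_one _)
  have hmarkov := mul_meas_ge_le_integral_of_nonneg
    (Eventually.of_forall fun z => cutoff_nonneg (ε * F z)) hint 2⁻¹
  calc μ {z | 1 < |ε * F z|} ≤ μ {z | 2⁻¹ ≤ cutoff (ε * F z)} :=
        measure_mono fun z hz => half_le_cutoff (le_of_lt hz)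
    _ = ENNReal.ofReal (μ.real {z | 2⁻¹ ≤ cutoff (ε * F z)}) := (ofReal_measureReal).symm
    _ ≤ ENNReal.ofReal (2 * r) := ENNReal.ofReal_le_ofReal (by linarith)

theorem tendsto_integral_cutoff {Z : Type*} [MeasurableSpace Z] (μ : Measure Z) [IsFiniteMeasure μ]
    {F : Z → ℝ} (hF : Measurable F) :
    Tendsto (fun k : ℕ => ∫ z, cutoff (1 / ((k : ℝ) + 1) * F z) ∂μ) atTop (𝓝 0) := by
  have h : Tendsto (fun k : ℕ => ∫ z, cutoff (1 / ((k : ℝ) + 1) * F z) ∂μ) atTop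
      (𝓝 (∫ _, (0 : ℝ) ∂μ)) := by
    refine tendsto_integral_of_dominated_convergence (fun _ => 1)
      (fun k => (continuous_cutoff.measurable.comp (hF.const_mul _)).aestronglyMeasurable)
      (integrable_const _) (fun k => Eventually.of_forall fun z => ?_)
      (Eventually.of_forall fun z => ?_)
    · rw [Real.norm_of_nonneg (cutoff_nonneg _)]
      exact cutoff_le_one _
    · have h0 : cutoff 0 = 0 := by simp [cutoff]
      have := (tendsto_one_div_add_atTop_nhds_zero_nat (𝕜 := ℝ)).mul_const (F z)
      rw [zero_mul] at this
      exact h0 ▸ (continuous_cutoff.tendsto 0).comp this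
  simpa using h

theorem IsSubMarkov.measureReal_compProd_univ_le {T : ℝ} (hT : 0 ≤ T) {E : Type*}
    [MeasurableSpace E] {κ : Kernel (Icc (0 : ℝ) T) E} (hκ : IsSubMarkov κ) :
    (timeMeasure T ⊗ₘ κ).real univ ≤ T :=
  (ENNReal.toReal_mono (measure_ne_top _ _) (hκ.compProd_univ_le _)).trans_eq
    (measureReal_timeMeasure_univ hT)

namespace ProblemData

variable {T : ℝ} {O A : Set ℝ} {D : ProblemData T O A}

theorem isCb12_mul_cutoff (hT : 0 < T) (hO : IsOpen O) {p p' : ℝ → ℝ}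
    (hp : ∀ t, HasDerivAt p (p' t) t) (hp' : Continuous p') (ε : ℝ) :
    IsCb12 T (closure O) fun t x => p t * cutoff (ε * x) := by
  refine isCb12_mul hT (uniqueDiffOn_closure_of_isOpen hO) hp hp' (hasDerivAt_cutoff_mul ε)
    (hasDerivAt_cutoffDeriv_mul ε) ((continuous_cutoffDeriv₂.comp (by fun_prop)).const_mul _)
    (B := 1 + |ε| + 6 * ε ^ 2) (fun x => ?_) (fun x => ?_) (fun x => ?_)
  · rw [abs_of_nonneg (cutoff_nonneg _)]
    linarith [cutoff_le_one (ε * x), abs_nonneg ε, sq_nonneg ε]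
  · rw [abs_mul]
    nlinarith [abs_cutoffDeriv_le (ε * x), abs_nonneg ε, sq_nonneg ε]
  · rw [abs_mul, abs_of_nonneg (sq_nonneg ε)]
    nlinarith [abs_cutoffDeriv₂_le (ε * x), abs_nonneg ε, sq_nonneg ε]

/-- The drift and diffusion terms are of order `ε` on test functions that depend on `ε x`. -/
theorem generator_mul_cutoff_le (hT : 0 < T) (hO : IsOpen O) {B S : ℝ} (hB : ∀ z, |D.b z| ≤ B)
    (hS : ∀ z, |D.σ z| ≤ S) {p p' : ℝ → ℝ} (hp : ∀ t, HasDerivAt p (p' t) t)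
    {ε : ℝ} (hε0 : 0 ≤ ε) (hε1 : ε ≤ 1) {P : ℝ} (hP : ∀ t ∈ Icc (0 : ℝ) T, |p t| ≤ P)
    (z : Icc (0 : ℝ) T × closure O × A) :
    D.generator (fun t x => p t * cutoff (ε * x)) z ≤
      p' z.1 * cutoff (ε * z.2.1) + P * (ε * (B + 3 * S ^ 2)) := by
  rw [generator_mul hT hO hp (hasDerivAt_cutoff_mul ε) (hasDerivAt_cutoffDeriv_mul ε)]
  have hb := hB (z.1, (z.2.1 : ℝ), z.2.2)
  have hσ := hS (z.1, (z.2.1 : ℝ), z.2.2)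
  set b := D.b (z.1, (z.2.1 : ℝ), z.2.2)
  set σ := D.σ (z.1, (z.2.1 : ℝ), z.2.2)
  have hp := hP z.1 z.1.2
  have h1 := abs_cutoffDeriv_le (ε * z.2.1)
  have h2 := abs_cutoffDeriv₂_le (ε * z.2.1)
  have hP0 : 0 ≤ P := (abs_nonneg _).trans hp
  have hB0 : 0 ≤ B := (abs_nonneg _).trans hb
  have e1 : b * (p z.1 * (ε * cutoffDeriv (ε * z.2.1))) ≤ B * (P * (ε * 1)) := by
    refine (le_abs_self _).trans ?_
    rw [abs_mul, abs_mul, abs_mul, abs_of_nonneg hε0]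
    gcongr
  have e2 : σ ^ 2 / 2 * (p z.1 * (ε ^ 2 * cutoffDeriv₂ (ε * z.2.1))) ≤
      S ^ 2 / 2 * (P * (ε * 6)) := by
    refine (le_abs_self _).trans ?_
    rw [abs_mul, abs_mul, abs_mul, abs_div, abs_pow, abs_pow, abs_two, abs_of_nonneg hε0]
    have : ε ^ 2 ≤ ε := by nlinarith
    gcongr
  linarith

/-- Bounds on the tails of both components of an admissible pair, from the test functions
`cutoff (ε * x)` and `(T - t) * cutoff (ε * x)`. -/
theorem integral_cutoff_le (hT : 0 < T) (hO : IsOpen O) (hD : SingleAgentAssumption D) {B S : ℝ}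
    (hB : ∀ z, |D.b z| ≤ B) (hB0 : 0 ≤ B) (hS : ∀ z, |D.σ z| ≤ S) {ε : ℝ} (hε0 : 0 ≤ ε)
    (hε1 : ε ≤ 1) {q : Measure (Icc (0 : ℝ) T × closure O) ×
      Kernel (Icc (0 : ℝ) T) (closure O × A)} (hq : q ∈ D.kernelAdmissible) :
    ∫ z, cutoff (ε * z.2) ∂q.1 ≤
        ∫ x : O, cutoff (ε * x) ∂(D.m₀ : Measure O) + T * (ε * (B + 3 * S ^ 2)) ∧
      ∫ z, cutoff (ε * z.2.1) ∂(timeMeasure T ⊗ₘ q.2) ≤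
        T * (∫ x : O, cutoff (ε * x) ∂(D.m₀ : Measure O) + T * (ε * (B + 3 * S ^ 2))) := by
  have := hq.1
  have := hq.2.1.isFiniteKernel
  set L := ε * (B + 3 * S ^ 2)
  have hL : 0 ≤ L := by positivity
  set M := timeMeasure T ⊗ₘ q.2
  have hM : M.real univ ≤ T := hq.2.1.measureReal_compProd_univ_le hT.le
  have hcM : Integrable (fun z : Icc (0 : ℝ) T × closure O × A => cutoff (ε * z.2.1)) M :=
    Integrable.of_bound (continuous_cutoff.measurable.comp
      (Measurable.const_mul (by fun_prop) ε)).aestronglyMeasurable 1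
      (Eventually.of_forall fun z => by
        rw [Real.norm_of_nonneg (cutoff_nonneg _)]; exact cutoff_le_one _)
  constructor
  · have hp : ∀ t : ℝ, HasDerivAt (fun _ : ℝ => (1 : ℝ)) ((fun _ : ℝ => (0 : ℝ)) t) t := fun t =>
      hasDerivAt_const t 1
    have hu := isCb12_mul_cutoff hT hO hp continuous_const ε
    have key := hq.2.2 _ hu
    have hle : ∫ z, D.generator (fun t x => 1 * cutoff (ε * x)) z ∂M ≤ ∫ _, L ∂M := by
      refine integral_mono (integrable_generator hD hu M) (integrable_const _) fun z => ?_
      have := generator_mul_cutoff_le hT hO hB hS hp hε0 hε1 (P := 1) (by simp) z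
      simpa using this
    rw [integral_const, smul_eq_mul] at hle
    simp only [one_mul] at key hle
    nlinarith
  · have hp : ∀ t : ℝ, HasDerivAt (fun t : ℝ => T - t) ((fun _ : ℝ => (-1 : ℝ)) t) t := fun t =>
      (hasDerivAt_id t).const_sub T
    have hu := isCb12_mul_cutoff hT hO hp continuous_const ε
    have key := hq.2.2 _ hu
    have hle : ∫ z, D.generator (fun t x => (T - t) * cutoff (ε * x)) z ∂M ≤
        ∫ z, (T * L - cutoff (ε * z.2.1)) ∂M := by
      refine integral_mono (integrable_generator hD hu M) ((integrable_const _).sub hcM)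
        fun z => ?_
      have := generator_mul_cutoff_le hT hO hB hS hp hε0 hε1 (P := T)
        (fun t ht => by rw [abs_of_nonneg] <;> linarith [ht.1, ht.2]) z
      linarith
    rw [integral_sub (integrable_const _) hcM, integral_const, smul_eq_mul] at hle
    have hnn : 0 ≤ ∫ z, (T - z.1) * cutoff (ε * z.2) ∂q.1 := integral_nonneg fun z =>
      mul_nonneg (sub_nonneg.2 z.1.2.2) (cutoff_nonneg _)
    rw [key, integral_const_mul, sub_zero] at hnn
    nlinarith [mul_le_mul_of_nonneg_right hM (mul_nonneg hT.le hL)]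

/-- The admissible pairs are uniformly tight; as `A` and `[0, T]` are compact, only the tails in `x`
matter. -/
theorem exists_tight (hT : 0 < T) (hO : IsOpen O) (hA : IsCompact A)
    (hD : SingleAgentAssumption D) :
    ∃ (K : ℕ → Set (Icc (0 : ℝ) T × closure O)) (K' : ℕ → Set (Icc (0 : ℝ) T × closure O × A))
      (u : ℕ → ℝ≥0), (∀ k, IsCompact (K k)) ∧ (∀ k, IsCompact (K' k)) ∧ Tendsto u atTop (𝓝 0) ∧
      (∀ q ∈ D.kernelAdmissible, ∀ k, q.1 (K k)ᶜ ≤ u k) ∧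
      ∀ q ∈ D.kernelAdmissible, ∀ k, (timeMeasure T ⊗ₘ q.2) (K' k)ᶜ ≤ u k := by
  have : CompactSpace A := isCompact_iff_compactSpace.1 hA
  obtain ⟨B, hB⟩ := hD.b_regular.2.1
  obtain ⟨S, hS⟩ := hD.σ_regular.2.1
  let ε : ℕ → ℝ := fun k => 1 / ((k : ℝ) + 1)
  have hε0 : ∀ k, 0 < ε k := fun k => Nat.one_div_pos_of_nat
  have hε1 : ∀ k, ε k ≤ 1 := fun k => by
    rw [div_le_one (by positivity)]
    linarith [(Nat.cast_nonneg k : (0 : ℝ) ≤ k)]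
  let r : ℕ → ℝ := fun k =>
    ∫ x : O, cutoff (ε k * x) ∂(D.m₀ : Measure O) + T * (ε k * (|B| + 3 * S ^ 2))
  have hr0 : ∀ k, 0 ≤ r k := fun k => add_nonneg (integral_nonneg fun x => cutoff_nonneg _)
    (mul_nonneg hT.le (mul_nonneg (hε0 k).le (by positivity)))
  have hr : Tendsto r atTop (𝓝 0) := by
    have h1 := tendsto_integral_cutoff (D.m₀ : Measure O) (F := fun x : O => (x : ℝ))
      measurable_subtype_coe
    have h2 := ((tendsto_one_div_add_atTop_nhds_zero_nat (𝕜 := ℝ)).mul_const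
      (|B| + 3 * S ^ 2)).const_mul T
    simpa only [zero_mul, mul_zero, add_zero] using h1.add h2
  have hball : ∀ k, IsCompact ((↑) ⁻¹' {x : ℝ | |ε k * x| ≤ 1} : Set (closure O)) := fun k => by
    refine isClosed_closure.isClosedEmbedding_subtypeVal.isCompact_preimage ?_
    have : {x : ℝ | |ε k * x| ≤ 1} = Metric.closedBall 0 (ε k)⁻¹ := by
      ext x
      rw [mem_ofPred_eq, abs_mul, abs_of_pos (hε0 k), mem_closedBall_zero_iff, Real.norm_eq_abs,
        ← one_div, le_div_iff₀' (hε0 k)]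
    rw [this]
    exact isCompact_closedBall _ _
  refine ⟨fun k => univ ×ˢ ((↑) ⁻¹' {x : ℝ | |ε k * x| ≤ 1}),
    fun k => univ ×ˢ (((↑) ⁻¹' {x : ℝ | |ε k * x| ≤ 1}) ×ˢ univ),
    fun k => (2 * ((1 + T) * r k)).toNNReal, fun k => isCompact_univ.prod (hball k),
    fun k => isCompact_univ.prod ((hball k).prod isCompact_univ), ?_, fun q hq k => ?_,
    fun q hq k => ?_⟩
  · simpa using tendsto_real_toNNReal ((hr.const_mul (1 + T)).const_mul 2)
  · have := hq.1
    have h := measure_lt_abs_mul_le (μ := q.1) (F := fun z => (z.2 : ℝ)) (by fun_prop) (ε k)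
      (r := (1 + T) * r k)
      ((integral_cutoff_le hT hO hD (fun z => (hB z).trans (le_abs_self B)) (abs_nonneg B) hS
        (hε0 k).le (hε1 k) hq).1.trans (by nlinarith [mul_nonneg hT.le (hr0 k)]))
    refine (measure_mono fun z hz => ?_).trans h
    simpa using hz
  · have := hq.2.1.isFiniteKernel
    have h := measure_lt_abs_mul_le (μ := timeMeasure T ⊗ₘ q.2) (F := fun z => (z.2.1 : ℝ))
      (by fun_prop) (ε k) (r := (1 + T) * r k)
      ((integral_cutoff_le hT hO hD (fun z => (hB z).trans (le_abs_self B)) (abs_nonneg B) hS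
        (hε0 k).le (hε1 k) hq).2.trans (by nlinarith [mul_nonneg hT.le (hr0 k)]))
    refine (measure_mono fun z hz => ?_).trans h
    simpa using hz

/-- If `g ≤ c` with `0 ≤ c`, the terminal reward is `c` minus the integral of the nonnegative
function `c - g`, which may be infinite. -/
theorem terminalReward_eq {c : ℝ} (hg : Measurable D.g) (hc0 : 0 ≤ c) (hc : ∀ z, D.g z ≤ c)
    (μ : ProbabilityMeasure (Icc (0 : ℝ) T × closure O)) :
    D.terminalReward μ = (c : EReal) -
      ((∫⁻ z, ENNReal.ofReal (c - D.g z) ∂(μ : Measure (Icc (0 : ℝ) T × closure O)) : ℝ≥0∞) :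
        EReal) := by
  unfold terminalReward
  set a := ∫⁻ z, ENNReal.ofReal (D.g z) ∂(μ : Measure (Icc (0 : ℝ) T × closure O))
  set b := ∫⁻ z, ENNReal.ofReal (-D.g z) ∂(μ : Measure (Icc (0 : ℝ) T × closure O))
  set d := ∫⁻ z, ENNReal.ofReal (c - D.g z) ∂(μ : Measure (Icc (0 : ℝ) T × closure O))
  have ha : a ≠ ∞ := by
    refine ((lintegral_mono fun z => ENNReal.ofReal_le_ofReal (hc z)).trans_lt ?_).ne
    simp
  have hsum : d + a = ENNReal.ofReal c + b := by
    have h1 : d + a = ∫⁻ z, (ENNReal.ofReal (c - D.g z) + ENNReal.ofReal (D.g z))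
        ∂(μ : Measure (Icc (0 : ℝ) T × closure O)) :=
      (lintegral_add_right _ hg.ennreal_ofReal).symm
    have h2 : ENNReal.ofReal c + b = ∫⁻ z, (ENNReal.ofReal c + ENNReal.ofReal (-D.g z))
        ∂(μ : Measure (Icc (0 : ℝ) T × closure O)) := by
      rw [lintegral_add_left measurable_const]; simp [b]
    rw [h1, h2]
    refine lintegral_congr fun z => ?_
    rcases le_total 0 (D.g z) with h | h
    · rw [ENNReal.ofReal_of_nonpos (neg_nonpos.2 h), add_zero,
        ← ENNReal.ofReal_add (sub_nonneg.2 (hc z)) h, sub_add_cancel]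
    · rw [ENNReal.ofReal_of_nonpos h, add_zero, ← ENNReal.ofReal_add hc0 (neg_nonneg.2 h),
        sub_eq_add_neg]
  by_cases hb : b = ∞
  · have hd : d = ∞ := by
      by_contra hd
      exact (ENNReal.add_ne_top.2 ⟨hd, ha⟩) (by rw [hsum, hb, add_top])
    simp [hb, hd, EReal.sub_top]
  · have hd : d ≠ ∞ := fun hd => by
      rw [hd, top_add] at hsum
      exact (ENNReal.add_ne_top.2 ⟨ENNReal.ofReal_ne_top, hb⟩) hsum.symm
    have hreal : d.toReal + a.toReal = c + b.toReal := by
      rw [← ENNReal.toReal_add hd ha, hsum, ENNReal.toReal_add ENNReal.ofReal_ne_top hb,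
        ENNReal.toReal_ofReal hc0]
    rw [← EReal.coe_ennreal_toReal ha, ← EReal.coe_ennreal_toReal hb,
      ← EReal.coe_ennreal_toReal hd, ← EReal.coe_sub, ← EReal.coe_sub, EReal.coe_eq_coe_iff]
    linarith

/-- The objective is a constant minus the cost, provided `∫ f d(lam ⊗ κ) ≤ Λ`. -/
theorem objective_eq {c Λ : ℝ} (hg : Measurable D.g) (hc0 : 0 ≤ c) (hc : ∀ z, D.g z ≤ c)
    {q : ProbabilityMeasure (Icc (0 : ℝ) T × closure O) × PosFlow T (closure O × A)}
    {κ : Kernel (Icc (0 : ℝ) T) (closure O × A)}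
    (hq : q.2.1.integral D.f = ∫ z, D.f z ∂(timeMeasure T ⊗ₘ κ))
    (hΛ : ∫ z, D.f z ∂(timeMeasure T ⊗ₘ κ) ≤ Λ) :
    D.objective q = ((Λ + c : ℝ) : EReal) -
      (cost (timeMeasure T) Λ D.f (fun z => c - D.g z) ((q.1 : Measure _), κ) : EReal) := by
  unfold objective cost
  rw [terminalReward_eq hg hc0 hc, hq, EReal.coe_ennreal_add, EReal.coe_ennreal_ofReal,
    max_eq_left (sub_nonneg.2 hΛ)]
  dsimp only
  set F := ∫ z, D.f z ∂(timeMeasure T ⊗ₘ κ)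
  induction (∫⁻ z, ENNReal.ofReal (c - D.g z) ∂(q.1 : Measure (Icc (0 : ℝ) T × closure O)))
    using ENNReal.recTopCoe with
  | top =>
    simp only [EReal.coe_ennreal_top, EReal.top_add_coe, EReal.sub_top, EReal.add_bot]
  | coe d =>
    have : (((d : ℝ≥0∞)) : EReal) = ((d : ℝ) : EReal) := rfl
    rw [this]
    norm_cast
    ring

theorem integral_f_le (hT : 0 < T) {C : ℝ} (hC : ∀ z, |D.f z| ≤ |C|)
    {κ : Kernel (Icc (0 : ℝ) T) (closure O × A)} (hκ : IsSubMarkov κ) :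
    ∫ z, D.f z ∂(timeMeasure T ⊗ₘ κ) ≤ |C| * T := by
  have := hκ.isFiniteKernel
  refine (Real.le_norm_self _).trans ((norm_integral_le_of_norm_le_const
    (Eventually.of_forall hC)).trans ?_)
  exact mul_le_mul_of_nonneg_left (hκ.measureReal_compProd_univ_le hT.le) (abs_nonneg _)

theorem exists_objective_eq_iSup (hT : 0 < T) (hO : IsOpen O) (hA : IsCompact A)
    (hD : SingleAgentAssumption D) :
    ∃ q ∈ D.admissible, D.objective q = ⨆ q' ∈ D.admissible, D.objective q' := by
  have : PolishSpace (closure O) := isClosed_closure.polishSpace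
  have : PolishSpace A := hA.isClosed.polishSpace
  have : PolishSpace (Icc (0 : ℝ) T) := isClosed_Icc.polishSpace
  obtain ⟨C₀, hC₀⟩ := hD.f_bounded
  obtain ⟨c₀, hc₀⟩ := hD.g_bddAbove
  let C := |C₀|
  have hC : ∀ z, |D.f z| ≤ C := fun z => (hC₀ z).trans (le_abs_self _)
  let c := |c₀|
  have hc : ∀ z, D.g z ≤ c := fun z => (hc₀ ⟨z, rfl⟩).trans (le_abs_self _)
  have hg : Measurable D.g := hD.g_usc.measurable
  obtain ⟨K, K', u, hK, hK', hu, hKu, hKu'⟩ := exists_tight hT hO hA hD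
  obtain ⟨p, hp, hmin⟩ := exists_minimizer_cost (lam := timeMeasure T) (Λ := C * T)
    hD.f_measurable hC hD.f_usc (G := fun z => c - D.g z)
    (fun z y hy => by
      filter_upwards [hD.g_usc z (c - y) (by linarith)] with w hw
      linarith)
    (fun z => sub_nonneg.2 (hc z)) (kernelAdmissible_nonempty (D := D) hT)
    (isMidpointClosed_kernelAdmissible hD) (fun p hp => hp.1) (fun p hp => hp.2.1)
    hK hK' hu hKu hKu' fun μs κs μ κ hmem hμ hκ h =>
      mem_kernelAdmissible_of_tendsto hD hmem hμ hκ h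
  have := hp.1
  let μ : ProbabilityMeasure (Icc (0 : ℝ) T × closure O) := ⟨p.1, hp.1⟩
  refine ⟨(μ, PosFlow.ofKernel p.2 hp.2.1), ofKernel_mem_admissible hD (μ := μ) hp,
    le_antisymm (le_iSup₂_of_le _ (ofKernel_mem_admissible hD (μ := μ) hp) le_rfl)
      (iSup₂_le fun q hq => ?_)⟩
  obtain ⟨κ, hκ, hint⟩ := exists_kernel_of_mem_admissible hT hO hD hq
  rw [objective_eq hg (abs_nonneg c₀) hc (hint _ C hD.f_measurable hC) (integral_f_le hT hC hκ.2.1),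
    objective_eq (κ := p.2) hg (abs_nonneg c₀) hc
      (PosFlow.integral_ofKernel hp.2.1 hD.f_measurable hC) (integral_f_le hT hC hp.2.1)]
  exact EReal.sub_le_sub le_rfl (EReal.coe_ennreal_le_coe_ennreal_iff.2 (hmin _ hκ))

end ProblemData

end LPControl

theorem mainTheorem4 (T : ℝ) (hT : 0 < T) (O A : Set ℝ) (hO : IsOpen O) (hA : IsCompact A)
    (D : LPControl.ProblemData T O A) (hD : LPControl.SingleAgentAssumption D) :
    ∃ q ∈ D.admissible, D.objective q = ⨆ q' ∈ D.admissible, D.objective q' :=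
  LPControl.ProblemData.exists_objective_eq_iSup hT hO hA hD
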